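/- Let $d \ge 1$ and $t \in \{0,1,2,3\}$. Definitions. A finite set $\mathcal V \subset \mathrm U(d)$ with a weight function $w : \mathcal V \to [0,1]$ is a (weighted) *unitary $t$-design* if for every linear map $M$ on $(\mathbb C^d)^{\otimes t}$ $$\sum_{V \in \mathcal V} w(V)\, V^{\otimes t} M (V^{\otimes t})^\dagger = \int_{\mathrm U(d)} U^{\otimes t} M (U^{\otimes t})^\dagger \, dU$$ ($dU$ the normalized Haar measure). A finite set $\mathcal V \subset \mathrm O(d)$ with weights $w : \mathcal V \to [0,1]$ is a (weighted) *orthogonal $t$-design* if the same holds with $\mathrm O(d)$ and its normalized Haar measure in place of $\mathrm U(d)$. If no weight function is mentioned, it is the constant $1/|\mathcal V|$. For finite subsets $\mathcal V_1,\dots,\mathcal V_\ell \subset \mathrm U(d)$ the *multiplicity weight* on the product set $\mathcal V_1 \cdots \mathcal V_\ell$ is $$w(U) = \frac{|\{(h_1,\dots,h_\ell) \in \mathcal V_1 \times \dots \times \mathcal V_\ell : h_1 \cdots h_\ell = U\}|}{|\mathcal V_1| \cdots |\mathcal V_\ell|}.$$ If $\mathcal V_1,\dots,\mathcal V_\ell$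 are finite subgroups of $\mathrm U(d)$, then $\mathcal V_1 \cdots \mathcal V_\ell$ is a *generalized group $t$-design* if it is a unitary $t$-design with the multiplicity weight. Regard $\mathrm O(d) \subset \mathrm U(d)$ and put $\mathcal V^W = \{ W V W^\dagger : V \in \mathcal V \}$. For real $x$ let $\omega_{2d}^x = \exp(2\pi i x/(2d))$, and for real $\alpha$ let $W_\alpha \in \mathrm U(d)$ be the diagonal unitary with $W_\alpha |j\rangle = \omega_{2d}^{j\alpha} |j\rangle$, $j = 0, \dots, d-1$. Theorem. There is a real $\alpha$ with $$\Bigl|\sum_{j=0}^{d-1} \omega_{2d}^{2\alpha j}\Bigr|^2 = \frac{2d}{d+1},$$ and for every such $\alpha$, with $W = W_\alpha$ (which depends on neither $t$ nor $\mathcal V$), the following hold. 1. If a finite subgroup $\mathcal V < \mathrm O(d)$ is an orthogonal $t$-design, then $\mathcal V^W \cdot \mathcal V$ is a generalized group $t$-design (with the subgroups $\mathcal V^W$ and $\mathcal V$ of $\mathrm U(d)$). 2. If an arbitrary finite set $\mathcal V \subset \mathrm O(d)$ is an orthogonal $t$-design, then $\mathcal V^W \cdot \mathcal V$ with the multiplicity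 weight is a unitary $t$-design. 3. If a finite set $\mathcal V \subset \mathrm O(d)$ with weight function $w$ is a weighted orthogonal $t$-design, then $\mathcal V^W \cdot \mathcal V$ with the weight function $X \mapsto \sum_{(A,B) \in \mathcal V \times \mathcal V,\ W A W^\dagger B = X} w(A)\, w(B)$ is a weighted unitary $t$-design. -/

import Mathlib

open MeasureTheory
open scoped Matrix

noncomputable section

namespace GroupDesign

/-- The unitary group `U(d)`. -/
abbrev UGroup (d : ℕ) : Submonoid (Matrix (Fin d) (Fin d) ℂ) := Matrix.unitaryGroup (Fin d) ℂ

/-- The real orthogonal group `O(d)`: real `d × d` matrices with `O * Oᵀ = 1`. -/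
abbrev OGroup (d : ℕ) : Submonoid (Matrix (Fin d) (Fin d) ℝ) := Matrix.unitaryGroup (Fin d) ℝ

theorem OGroup_eq_orthogonalGroup (d : ℕ) : OGroup d = Matrix.orthogonalGroup (Fin d) ℝ := rfl

/-- The unitary group (over `ℝ` or `ℂ`) is compact in the topology of the matrix entries. -/
instance compactSpace_unitaryGroup (d : ℕ) (𝕜 : Type*) [RCLike 𝕜] :
    CompactSpace (Matrix.unitaryGroup (Fin d) 𝕜) := by
  have hK : IsCompact (Set.pi Set.univ fun _ : Fin d =>
      Set.pi Set.univ fun _ : Fin d => Metric.closedBall (0 : 𝕜) 1) :=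
    isCompact_univ_pi fun _ => isCompact_univ_pi fun _ => isCompact_closedBall _ _
  have hcl : IsClosed {A : Matrix (Fin d) (Fin d) 𝕜 | A * star A = 1} :=
    isClosed_eq (continuous_id.mul continuous_star) continuous_const
  refine isCompact_iff_compactSpace.mp
    (IsCompact.of_isClosed_subset (s := Set.pi Set.univ fun _ : Fin d =>
      Set.pi Set.univ fun _ : Fin d => Metric.closedBall (0 : 𝕜) 1) hK ?_ ?_)
  · have h : (Matrix.unitaryGroup (Fin d) 𝕜 : Set (Matrix (Fin d) (Fin d) 𝕜)) =
        {A | A * star A = 1} := Set.ext fun _ => Matrix.mem_unitaryGroup_iff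
    rw [h]
    exact hcl
  · intro A hA i _ j _
    simpa using entry_norm_bound_of_unitary hA i j

instance measurableSpace_unitaryGroup (d : ℕ) (𝕜 : Type*) [RCLike 𝕜] :
    MeasurableSpace (Matrix.unitaryGroup (Fin d) 𝕜) := borel _

instance borelSpace_unitaryGroup (d : ℕ) (𝕜 : Type*) [RCLike 𝕜] :
    BorelSpace (Matrix.unitaryGroup (Fin d) 𝕜) := ⟨rfl⟩

/-- The Haar measure of total mass one on `U(d)` (`𝕜 = ℂ`) or `O(d)` (`𝕜 = ℝ`). -/
def haarProb (d : ℕ) (𝕜 : Type*) [RCLike 𝕜] : Measure (Matrix.unitaryGroup (Fin d) 𝕜) :=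
  Measure.haarMeasure ⊤

/-- The inclusion `O(d) ⊂ U(d)`. -/
def complexify (d : ℕ) : OGroup d →* UGroup d where
  toFun O := ⟨(O : Matrix (Fin d) (Fin d) ℝ).map Complex.ofReal, by
    have h := Matrix.mem_unitaryGroup_iff.mp O.2
    rw [Matrix.mem_unitaryGroup_iff]
    have h2 := congrArg (fun A : Matrix (Fin d) (Fin d) ℝ => A.map Complex.ofRealHom) h
    simp only [Matrix.map_mul] at h2
    ext i j
    have h3 := congrFun (congrFun h2 i) j
    simpa [Matrix.mul_apply, Matrix.star_apply, Matrix.one_apply, apply_ite] using h3⟩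
  map_one' := by
    apply Subtype.ext
    ext i j
    simp [Matrix.one_apply, apply_ite]
  map_mul' A B := by
    apply Subtype.ext
    ext i j
    simp [Matrix.mul_apply]

variable {d : ℕ}

/-- The matrix of `A^{⊗ t}` on `(ℂ^d)^{⊗ t}` in the product basis `|i₁ … i_t⟩`, whose elements are
labelled by the functions `Fin t → Fin d`. -/
def tensorPower (t : ℕ) (A : Matrix (Fin d) (Fin d) ℂ) :
    Matrix (Fin t → Fin d) (Fin t → Fin d) ℂ :=
  fun i j => ∏ k, A (i k) (j k)

/-- `A^{⊗ t} M (A^{⊗ t})†`. -/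
def tensorConj (t : ℕ) (A : Matrix (Fin d) (Fin d) ℂ)
    (M : Matrix (Fin t → Fin d) (Fin t → Fin d) ℂ) :
    Matrix (Fin t → Fin d) (Fin t → Fin d) ℂ :=
  tensorPower t A * M * (tensorPower t A)ᴴ

/-- The `t`-fold twirl of `M` over `U(d)` (integral taken entry by entry). -/
def unitaryTwirl (t : ℕ) (M : Matrix (Fin t → Fin d) (Fin t → Fin d) ℂ) :
    Matrix (Fin t → Fin d) (Fin t → Fin d) ℂ :=
  fun i j => ∫ U : UGroup d, tensorConj t (U : Matrix (Fin d) (Fin d) ℂ) M i j ∂(haarProb d ℂ)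

/-- The `t`-fold twirl of `M` over `O(d)` (integral taken entry by entry). -/
def orthogonalTwirl (t : ℕ) (M : Matrix (Fin t → Fin d) (Fin t → Fin d) ℂ) :
    Matrix (Fin t → Fin d) (Fin t → Fin d) ℂ :=
  fun i j => ∫ O : OGroup d,
    tensorConj t (complexify d O : Matrix (Fin d) (Fin d) ℂ) M i j ∂(haarProb d ℝ)

/-- The finite set `V ⊂ U(d)` with weight function `w : V → [0, 1]` is a unitary `t`-design. -/
structure IsUnitaryDesign (t : ℕ) (V : Finset (UGroup d)) (w : UGroup d → ℝ) : Prop where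
  weight_mem : ∀ U ∈ V, w U ∈ Set.Icc (0 : ℝ) 1
  sum_eq : ∀ M : Matrix (Fin t → Fin d) (Fin t → Fin d) ℂ,
    ∑ U ∈ V, (w U : ℂ) • tensorConj t (U : Matrix (Fin d) (Fin d) ℂ) M = unitaryTwirl t M

/-- The finite set `V ⊂ O(d)` with weight function `w : V → [0, 1]` is an orthogonal
`t`-design. -/
structure IsOrthogonalDesign (t : ℕ) (V : Finset (OGroup d)) (w : OGroup d → ℝ) : Prop where
  weight_mem : ∀ O ∈ V, w O ∈ Set.Icc (0 : ℝ) 1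
  sum_eq : ∀ M : Matrix (Fin t → Fin d) (Fin t → Fin d) ℂ,
    ∑ O ∈ V, (w O : ℂ) • tensorConj t (complexify d O : Matrix (Fin d) (Fin d) ℂ) M
      = orthogonalTwirl t M

/-- The constant weight function `1 / |V|`. -/
def uniformWeight {X : Type*} (V : Finset X) : X → ℝ := fun _ => 1 / (V.card : ℝ)

open Classical in
/-- The set of all products `h₁ * ⋯ * h_ℓ` with `h_j ∈ V j`. -/
def productSet {ℓ : ℕ} (V : Fin ℓ → Finset (UGroup d)) : Finset (UGroup d) :=
  (Fintype.piFinset V).image fun h => (List.ofFn h).prod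

open Classical in
/-- The number of ways to write `U = h₁ * ⋯ * h_ℓ` with `h_j ∈ V j`, divided by
`|V 1| ⋯ |V ℓ|`. -/
def productWeight {ℓ : ℕ} (V : Fin ℓ → Finset (UGroup d)) (U : UGroup d) : ℝ :=
  (((Fintype.piFinset V).filter fun h => (List.ofFn h).prod = U).card : ℝ) /
    ∏ j, ((V j).card : ℝ)

/-- The product `G 1 ⋯ G ℓ` of subgroups of `U(d)` is a generalized group `t`-design. -/
structure IsGeneralizedGroupDesign (t : ℕ) {ℓ : ℕ} (G : Fin ℓ → Subgroup (UGroup d)) : Prop where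
  finite : ∀ j, (G j : Set (UGroup d)).Finite
  design : IsUnitaryDesign t (productSet fun j => (finite j).toFinset)
    (productWeight fun j => (finite j).toFinset)

/-- `ω_{2d}^x = exp (2 π i x / (2 d))` for a real exponent `x`, where
`ω_{2d} = exp (2 π i / (2 d))`. -/
def omegaPow (d : ℕ) (x : ℝ) : ℂ :=
  Complex.exp (2 * Real.pi * Complex.I / (2 * d) * x)

/-- `q(α) = |∑_{j=0}^{d-1} ω_{2d}^{2 α j}|²`. -/
def q (d : ℕ) (α : ℝ) : ℝ := ‖∑ j : Fin d, omegaPow d (2 * α * (j : ℕ))‖ ^ 2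

/-- The diagonal unitary `W |j⟩ = ω_{2d}^{j α} |j⟩`, `j = 0, …, d - 1`. -/
def W (d : ℕ) (α : ℝ) : UGroup d :=
  ⟨Matrix.diagonal fun j : Fin d => omegaPow d ((j : ℕ) * α), by
    rw [Matrix.mem_unitaryGroup_iff, Matrix.star_eq_conjTranspose,
      Matrix.diagonal_conjTranspose, Matrix.diagonal_mul_diagonal, ← Matrix.diagonal_one]
    congr 1
    funext j
    rw [Pi.star_apply, RCLike.star_def, omegaPow, ← Complex.exp_conj, ← Complex.exp_add]
    simp [neg_div, Complex.conj_ofNat]⟩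

/-- `A^U = {U V U† : V ∈ A}` for a subgroup `A` of `O(d)` and a unitary `U`. -/
def conjSubgroup (U : UGroup d) (A : Subgroup (OGroup d)) : Subgroup (UGroup d) :=
  (A.map (complexify d)).map (MulAut.conj U).toMonoidHom

open Classical in
/-- `V^U = {U A U† : A ∈ V}` for a finite set `V ⊂ O(d)` and a unitary `U`. -/
def conjSet (U : UGroup d) (V : Finset (OGroup d)) : Finset (UGroup d) :=
  V.image fun A => U * complexify d A * U⁻¹

open Classical in
/-- The finite set `V ⊂ O(d)` as a subset of `U(d)`. -/
def complexSet (V : Finset (OGroup d)) : Finset (UGroup d) := V.image (complexify d)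

open Classical in
/-- The weight that `w` induces on the products `(U A U†) B` with `A, B ∈ V`: the sum of
`w A * w B` over all pairs with the given product. -/
def convolutionWeight (U : UGroup d) (V : Finset (OGroup d)) (w : OGroup d → ℝ)
    (X : UGroup d) : ℝ :=
  ∑ p ∈ (V ×ˢ V).filter (fun p => U * complexify d p.1 * U⁻¹ * complexify d p.2 = X),
    w p.1 * w p.2

end GroupDesign

end

open GroupDesign

open MeasureTheory
open scoped Matrix

/-! Let `S` be the average of the conjugations by `V`, and `S'` the average of the conjugations by
`W V W†`. The induced product weights turn the required average into `S' ∘ S`, so it has to be shown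
that `S' ∘ S` is the unitary twirl. The design property makes `S` the orthogonal twirl and `S'` its
conjugate by `W`; nothing else about `V` enters except that its weights sum to one.

Both `S' ∘ S` and the unitary twirl are unchanged when their argument is conjugated by an orthogonal
matrix. It therefore suffices to compare them on Brauer diagrams. This is the dual form of Brauer's
theorem for `O(d)`, `eq_zero_of_brauer`. It is proved for at most `6 = 2 · 3` legs by taking traces:
an invariant tensor all of whose complete contractions vanish is traceless by induction, and a
traceless invariant tensor with one to six legs is zero (`IsInv.eq_zero_of_traceless`).

A diagram all of whose pairs join a row to a column is a permutation operator, fixed by every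
unitary conjugation. For `t ≤ 3` any other diagram has exactly one row-row and one column-column
pair. Conjugating it by `U = W O W†` produces an entry of `U Uᵀ` times a conjugated entry of `U Uᵀ`,
so the average over `O` needs only a second-order computation, done for `t = 2`. There the condition
on `q` says exactly that the average is `(1 + SWAP) / (d + 1)` (`orthogonalTwirl_cup_two`). Hence
`S'` sends every Brauer diagram to a unitarily invariant matrix, which must be its unitary twirl. -/

namespace GroupDesign

/-! ### Traceless invariant tensors with few legs vanish. -/

section

variable {d : ℕ} {ι : Type} [Fintype ι] [DecidableEq ι]

/-- A tensor with legs `ι` that is invariant under permutation matrices, sign changes of the basis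
vectors, and infinitesimal rotations of the coordinate planes. -/
structure IsInv (r : (ι → Fin d) → ℂ) : Prop where
  perm : ∀ (σ : Equiv.Perm (Fin d)) (f : ι → Fin d), r (σ ∘ f) = r f
  sign : ∀ (c : Fin d) (f : ι → Fin d), Odd (Finset.univ.filter fun m => f m = c).card → r f = 0
  lie : ∀ (a b : Fin d), a ≠ b → ∀ f : ι → Fin d,
    ∑ m, ((if f m = a then r (Function.update f m b) else 0)
      - (if f m = b then r (Function.update f m a) else 0)) = 0

/-- All contractions of two distinct legs of `r` vanish. -/
def Traceless (r : (ι → Fin d) → ℂ) : Prop :=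
  ∀ k l : ι, k ≠ l → ∀ f : ι → Fin d,
    ∑ x, r (Function.update (Function.update f k x) l x) = 0

omit [Fintype ι] in
theorem update_const_self (a : Fin d) (k : ι) :
    Function.update (fun _ : ι => a) k a = fun _ => a := by
  simp

/-- Put `c ≠ a` on the leg `p` and rotate in the plane of `a` and `c`: the constant value equals a
sum, over the other legs `m`, of values with `c` on both `p` and `m`. Summing over `c`,
tracelessness in `p` and `m` turns each inner sum into minus the constant value. -/
theorem IsInv.eq_zero_const {r : (ι → Fin d) → ℂ} (h : IsInv r) (ht : Traceless r)
    (hι : 2 ≤ Fintype.card ι) (a : Fin d) : r (fun _ => a) = 0 := by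
  obtain ⟨p⟩ : Nonempty ι := Fintype.card_pos_iff.mp (by omega)
  have hlie : ∀ c ∈ Finset.univ.erase a, r (fun _ => a) =
      ∑ m ∈ Finset.univ.erase p, r (Function.update (Function.update (fun _ => a) p c) m c) := by
    intro c hc
    have hca : c ≠ a := Finset.ne_of_mem_erase hc
    have h1 := h.lie a c hca.symm (Function.update (fun _ => a) p c)
    rw [← Finset.add_sum_erase _ _ (Finset.mem_univ p)] at h1
    have h2 : ∀ m ∈ Finset.univ.erase p,
        ((if Function.update (fun _ => a) p c m = a then
          r (Function.update (Function.update (fun _ => a) p c) m c) else 0)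
        - (if Function.update (fun _ => a) p c m = c then
          r (Function.update (Function.update (fun _ => a) p c) m a) else 0))
        = r (Function.update (Function.update (fun _ => a) p c) m c) := by
      intro m hm
      have hmp : m ≠ p := Finset.ne_of_mem_erase hm
      simp [Function.update_of_ne hmp, hca.symm]
    rw [Finset.sum_congr rfl h2] at h1
    simp only [Function.update_self, Function.update_idem, hca, if_false, if_true,
      update_const_self] at h1
    linear_combination -h1
  have htr : ∀ m ∈ Finset.univ.erase p,
      ∑ c ∈ Finset.univ.erase a, r (Function.update (Function.update (fun _ => a) p c) m c)
        = - r (fun _ => a) := by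
    intro m hm
    have h1 := ht p m (Finset.ne_of_mem_erase hm).symm (fun _ => a)
    rw [← Finset.add_sum_erase _ _ (Finset.mem_univ a)] at h1
    simp only [update_const_self] at h1
    linear_combination h1
  have h1 := Finset.sum_congr rfl hlie
  rw [Finset.sum_comm, Finset.sum_congr rfl htr] at h1
  simp only [Finset.sum_const, nsmul_eq_mul, Finset.card_erase_of_mem (Finset.mem_univ _),
    Finset.card_univ, Fintype.card_fin] at h1
  obtain ⟨n, hn⟩ : ∃ n, Fintype.card ι = n + 2 := ⟨_, (Nat.sub_add_cancel hι).symm⟩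
  rw [hn] at h1
  -- The coefficient is `(d - 1) + (card ι - 1)`, which is positive because there are at least two
  -- legs.
  have h2 : ((d - 1 + n + 1 : ℕ) : ℂ) * r (fun _ => a) = 0 := by
    push_cast
    simp only [Nat.add_succ_sub_one] at h1
    push_cast at h1
    linear_combination h1
  exact (mul_eq_zero.mp h2).resolve_left (Nat.cast_ne_zero.mpr (by omega))

/-- If only two legs carry `c`, replacing it there by an unused label `x` is the transposition of
`c` and `x`, so permutation invariance applies. -/
theorem update_update_comp_swap {f : ι → Fin d} {p k : ι} {c x : Fin d}
    (hf : Finset.univ.filter (fun m => f m = c) = {p, k})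
    (hx : x ∉ Finset.univ.image f) :
    Function.update (Function.update f p x) k x = Equiv.swap c x ∘ f := by
  funext m
  have hm : f m = c ↔ m = p ∨ m = k := by
    have := Finset.ext_iff.mp hf m
    simpa using this
  have hmx : f m ≠ x := fun e => hx (Finset.mem_image.mpr ⟨m, Finset.mem_univ _, e⟩)
  by_cases h : m = p ∨ m = k
  · have : f m = c := hm.mpr h
    rw [Function.comp_apply, this, Equiv.swap_apply_left]
    rcases h with rfl | rfl
    · by_cases hk : m = k
      · subst hk; simp
      · simp [Function.update_of_ne hk]
    · simp
  · push Not at h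
    rw [Function.comp_apply, Equiv.swap_apply_of_ne_of_ne (fun e => by
      rcases hm.mp e with e | e
      · exact h.1 e
      · exact h.2 e) hmx, Function.update_of_ne h.2, Function.update_of_ne h.1]

-- The bound of six legs is used here: two labels, each occurring at least four times, would need
-- eight legs.
omit [DecidableEq ι] in
theorem exists_fiber_card_two {f : ι → Fin d} (hcard : Fintype.card ι ≤ 6)
    (heven : ∀ c, Even (Finset.univ.filter fun m => f m = c).card)
    (him : 1 < (Finset.univ.image f).card) :
    ∃ c ∈ Finset.univ.image f, (Finset.univ.filter fun m => f m = c).card = 2 := by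
  by_contra! hne
  have h1 : Fintype.card ι = ∑ c ∈ Finset.univ.image f,
      (Finset.univ.filter fun m => f m = c).card :=
    Finset.card_eq_sum_card_image f Finset.univ
  have h2 : ∀ c ∈ Finset.univ.image f, 4 ≤ (Finset.univ.filter fun m => f m = c).card := by
    intro c hc
    have hpos : 0 < (Finset.univ.filter fun m => f m = c).card := by
      obtain ⟨m, -, hm⟩ := Finset.mem_image.mp hc
      exact Finset.card_pos.mpr ⟨m, by simp [hm]⟩
    obtain ⟨e, he⟩ := heven c
    have := hne c hc
    omega
  have h3 := Finset.card_nsmul_le_sum _ _ _ h2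
  rw [← h1, smul_eq_mul] at h3
  omega

/-- An invariant traceless tensor with between one and six legs vanishes. -/
theorem IsInv.eq_zero_of_traceless {r : (ι → Fin d) → ℂ} (h : IsInv r) (ht : Traceless r)
    (h0 : 0 < Fintype.card ι) (h6 : Fintype.card ι ≤ 6) : r = 0 := by
  -- Induction on the number of distinct labels in `f`.
  suffices ∀ n, ∀ f : ι → Fin d, (Finset.univ.image f).card = n → r f = 0 from
    funext fun f => this _ f rfl
  intro n
  induction n using Nat.strong_induction_on with
  | _ n ih =>
  intro f hfn
  by_cases heven : ∀ c, Even (Finset.univ.filter fun m => f m = c).card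
  swap
  · push Not at heven
    obtain ⟨c, hc⟩ := heven
    exact h.sign c f (Nat.not_even_iff_odd.mp hc)
  obtain ⟨m₀⟩ : Nonempty ι := Fintype.card_pos_iff.mp h0
  by_cases him : 1 < (Finset.univ.image f).card
  · obtain ⟨c, hc, hc2⟩ := exists_fiber_card_two h6 heven him
    obtain ⟨p, k, hpk, hfib⟩ := Finset.card_eq_two.mp hc2
    have h1 := ht p k hpk f
    have hpc : f p = c := by
      have : p ∈ Finset.univ.filter (fun m => f m = c) := by simp [hfib]
      simpa using this
    have hkc : f k = c := by
      have : k ∈ Finset.univ.filter (fun m => f m = c) := by simp [hfib]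
      simpa using this
    -- In the trace over `p` and `k`, another label already present gives fewer distinct labels and
    -- hence zero, while `c` itself or an unused label gives `r f`. So the trace is a positive
    -- multiple of `r f`.
    have h2 : ∀ x, r (Function.update (Function.update f p x) k x) =
        if x ∈ (Finset.univ.image f).erase c then 0 else r f := by
      intro x
      split_ifs with hx
      · refine ih _ ?_ _ rfl
        rw [← hfn]
        refine lt_of_le_of_lt (Finset.card_le_card (t := (Finset.univ.image f).erase c) ?_)
          (Finset.card_erase_lt_of_mem hc)
        intro y hy
        obtain ⟨m, -, rfl⟩ := Finset.mem_image.mp hy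
        by_cases hmk : m = k
        · subst hmk; simpa using hx
        by_cases hmp : m = p
        · subst hmp; simpa [Function.update_of_ne hmk] using hx
        rw [Function.update_of_ne hmk, Function.update_of_ne hmp]
        refine Finset.mem_erase.mpr ⟨fun e => ?_, Finset.mem_image_of_mem _ (Finset.mem_univ _)⟩
        have : m ∈ Finset.univ.filter (fun m => f m = c) := by simp [e]
        rw [hfib] at this
        simp [hmk, hmp] at this
      · by_cases hxc : x = c
        · subst hxc
          congr 1
          rw [Function.update_eq_self_iff.mpr, Function.update_eq_self_iff.mpr hpc.symm]
          rw [Function.update_eq_self_iff.mpr hpc.symm, hkc]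
        · have hx' : x ∉ Finset.univ.image f := fun e => hx (Finset.mem_erase.mpr ⟨hxc, e⟩)
          rw [update_update_comp_swap hfib hx', h.perm]
    simp only [h2] at h1
    rw [Finset.sum_ite, Finset.sum_const_zero, zero_add, Finset.sum_const, nsmul_eq_mul] at h1
    refine (mul_eq_zero.mp h1).resolve_left (Nat.cast_ne_zero.mpr ?_)
    exact (Finset.card_pos.mpr ⟨c, by simp⟩).ne'
  · have hconst : f = fun _ => f m₀ := by
      funext m
      exact Finset.card_le_one.mp (not_lt.mp him) _ (Finset.mem_image_of_mem _ (Finset.mem_univ _))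
        _ (Finset.mem_image_of_mem _ (Finset.mem_univ _))
    rw [hconst]
    refine h.eq_zero_const ht ?_ _
    have := heven (f m₀)
    rw [Finset.filter_true_of_mem (fun m _ => congrFun hconst m), Finset.card_univ] at this
    obtain ⟨e, he⟩ := this
    omega

end

/-! ### Contractions, and reduction to complete contractions. -/

section

variable {d : ℕ} {ι : Type} [Fintype ι] [DecidableEq ι]

/-- Extend a labelling of the legs other than `k` and `l` by the label `a` on `k` and `l`. -/
def extendLabel (k l : ι) (g : {m : ι // m ≠ k ∧ m ≠ l} → Fin d) (a : Fin d) : ι → Fin d :=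
  fun m => if h : m ≠ k ∧ m ≠ l then g ⟨m, h⟩ else a

/-- The contraction of a tensor along the legs `k` and `l`. -/
def contract (r : (ι → Fin d) → ℂ) (k l : ι) (g : {m : ι // m ≠ k ∧ m ≠ l} → Fin d) : ℂ :=
  ∑ a, r (extendLabel k l g a)

theorem sum_eq_add_sum_subtype {M : Type*} [AddCommMonoid M] {k l : ι} (hkl : k ≠ l) (F : ι → M) :
    ∑ m, F m = F k + F l + ∑ m : {m : ι // m ≠ k ∧ m ≠ l}, F m := by
  rw [← Finset.add_sum_erase _ _ (Finset.mem_univ k),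
    ← Finset.add_sum_erase _ _ (Finset.mem_erase.mpr ⟨hkl.symm, Finset.mem_univ l⟩), add_assoc]
  congr 2
  refine Finset.sum_subtype _ (fun m => ?_) _
  simp [and_comm]

section extendLabel

variable {k l : ι} (g : {m : ι // m ≠ k ∧ m ≠ l} → Fin d) (a b : Fin d)

omit [Fintype ι]

@[simp] theorem extendLabel_left : extendLabel k l g a k = a := by simp [extendLabel]

@[simp] theorem extendLabel_right : extendLabel k l g a l = a := by simp [extendLabel]

@[simp] theorem extendLabel_coe (m : {m : ι // m ≠ k ∧ m ≠ l}) : extendLabel k l g a m = g m := by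
  simp [extendLabel, m.2.1, m.2.2]

theorem extendLabel_update (m : {m : ι // m ≠ k ∧ m ≠ l}) :
    extendLabel k l (Function.update g m b) a = Function.update (extendLabel k l g a) m b := by
  funext x
  by_cases hx : x ≠ k ∧ x ≠ l
  · by_cases hxm : x = m
    · subst hxm; simp
    · rw [Function.update_of_ne hxm]
      have : (⟨x, hx⟩ : {m : ι // m ≠ k ∧ m ≠ l}) ≠ m := fun e => hxm (congrArg Subtype.val e)
      simp [extendLabel, hx, Function.update_of_ne this]
  · have : x ≠ m := fun e => hx (e ▸ m.2)
    rw [Function.update_of_ne this]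
    simp only [extendLabel, hx, dif_neg, not_false_iff]

theorem update_extendLabel_swap (hkl : k ≠ l) :
    Function.update (extendLabel k l g a) k b = Function.update (extendLabel k l g b) l a := by
  funext x
  by_cases hxk : x = k
  · subst hxk; simp [Function.update_of_ne hkl]
  by_cases hxl : x = l
  · subst hxl; simp [Function.update_of_ne hxk]
  · simp [extendLabel, hxk, hxl]

theorem update_update_eq_extendLabel (f : ι → Fin d) :
    Function.update (Function.update f k a) l a = extendLabel k l (fun m => f m) a := by
  funext x
  by_cases hxl : x = l
  · subst hxl; simp
  by_cases hxk : x = k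
  · subst hxk; simp [Function.update_of_ne hxl]
  · simp [extendLabel, hxk, hxl]

theorem comp_extendLabel (σ : Fin d → Fin d) :
    σ ∘ extendLabel k l g a = extendLabel k l (σ ∘ g) (σ a) := by
  funext x
  by_cases hx : x ≠ k ∧ x ≠ l
  · simp [extendLabel, hx]
  · simp only [extendLabel, hx, dif_neg, not_false_iff, Function.comp_apply]

end extendLabel

/-- A contracted pair of legs always carries equal labels: it adds an even number to each label
count, and its two contributions to an infinitesimal rotation cancel. -/
theorem IsInv.contract {r : (ι → Fin d) → ℂ} (h : IsInv r) {k l : ι} (hkl : k ≠ l) :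
    IsInv (contract r k l) where
  perm σ g := by
    unfold GroupDesign.contract
    rw [← Equiv.sum_comp σ]
    exact Finset.sum_congr rfl fun a _ => by rw [← comp_extendLabel, h.perm]
  sign c g hg := by
    refine Finset.sum_eq_zero fun a _ => h.sign c _ ?_
    rw [Finset.card_filter] at hg ⊢
    rw [sum_eq_add_sum_subtype hkl]
    simp only [extendLabel_left, extendLabel_right, extendLabel_coe]
    exact Even.add_odd ⟨_, rfl⟩ hg
  lie a b hab g := by
    have h1 : ∑ c, ∑ m, ((if extendLabel k l g c m = a
          then r (Function.update (extendLabel k l g c) m b) else 0)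
        - (if extendLabel k l g c m = b
          then r (Function.update (extendLabel k l g c) m a) else 0)) = 0 :=
      Finset.sum_eq_zero fun c _ => h.lie a b hab _
    simp only [sum_eq_add_sum_subtype hkl, extendLabel_left, extendLabel_right, extendLabel_coe,
      Finset.sum_add_distrib, Finset.sum_sub_distrib, Finset.sum_ite_eq', Finset.mem_univ,
      if_true] at h1
    rw [update_extendLabel_swap g a b hkl, update_extendLabel_swap g b a hkl] at h1
    unfold GroupDesign.contract
    simp only [extendLabel_update]
    have h2 : ∀ (x y : Fin d), ∑ c, ∑ m : {m : ι // m ≠ k ∧ m ≠ l},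
          (if g m = x then r (Function.update (extendLabel k l g c) m y) else 0) =
        ∑ m : {m : ι // m ≠ k ∧ m ≠ l},
          (if g m = x then ∑ c, r (Function.update (extendLabel k l g c) m y) else 0) := by
      intro x y
      rw [Finset.sum_comm]
      refine Finset.sum_congr rfl fun m _ => ?_
      split_ifs <;> simp
    rw [h2, h2] at h1
    rw [Finset.sum_sub_distrib]
    linear_combination h1

/-- Every value of `u` is attained exactly twice, so that `u` pairs up the legs `ι`. -/
def IsPairing {n : ℕ} (u : ι → Fin n) : Prop :=
  ∀ p, (Finset.univ.filter fun m => u m = p).card = 2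

/-- An invariant tensor with at most six legs vanishes if all its complete contractions do. -/
theorem IsInv.eq_zero_of_pairings {n : ℕ} (hn : n ≤ 3) (hι : Fintype.card ι = 2 * n)
    {r : (ι → Fin d) → ℂ} (h : IsInv r)
    (hr : ∀ u : ι → Fin n, IsPairing u → ∑ g : Fin n → Fin d, r (g ∘ u) = 0) : r = 0 := by
  induction n generalizing ι with
  | zero =>
    have : IsEmpty ι := Fintype.card_eq_zero_iff.mp hι
    funext f
    have h1 := hr isEmptyElim (fun p => p.elim0)
    rw [Fintype.sum_unique] at h1
    exact (congrArg r (Subsingleton.elim _ _)).trans h1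
  | succ n ih =>
    refine h.eq_zero_of_traceless (fun k l hkl f => ?_) (by omega) (by omega)
    simp only [update_update_eq_extendLabel]
    suffices GroupDesign.contract r k l = 0 from congrFun this _
    have hcard : Fintype.card {m : ι // m ≠ k ∧ m ≠ l} = 2 * n := by
      have := sum_eq_add_sum_subtype hkl (fun _ => 1)
      simp only [Finset.sum_const, Finset.card_univ, smul_eq_mul, mul_one] at this
      omega
    refine ih (by omega) hcard (h.contract hkl) fun u hu => ?_
    -- A pairing of the remaining legs extends to all legs: `k` and `l` form the new pair `0`, and
    -- the old pairs move up by one.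
    have hv := hr (fun m => if h : m ≠ k ∧ m ≠ l then (u ⟨m, h⟩).succ else 0) (fun p => by
      rw [Finset.card_filter, sum_eq_add_sum_subtype hkl]
      have h1 : ∀ m : {m : ι // m ≠ k ∧ m ≠ l}, (m : ι) ≠ k ∧ (m : ι) ≠ l := fun m => m.2
      simp only [ne_eq, not_true_eq_false, false_and, and_false, dite_false]
      simp only [← ne_eq, h1, Subtype.coe_eta]
      refine Fin.cases ?_ (fun p => ?_) p
      · simp [Fin.succ_ne_zero]
      · have := hu p
        rw [Finset.card_filter] at this
        simpa [(Fin.succ_ne_zero _).symm] using this)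
    rw [← Equiv.sum_comp (Fin.consEquiv fun _ => Fin d), Fintype.sum_prod_type_right] at hv
    rw [← hv]
    refine Finset.sum_congr rfl fun g _ => Finset.sum_congr rfl fun a _ => congrArg r ?_
    funext m
    by_cases hm : m ≠ k ∧ m ≠ l
    · simp [extendLabel, hm, Fin.consEquiv]
    · simp only [extendLabel, hm, dif_neg, not_false_iff, Fin.consEquiv, Function.comp_apply]
      simp

end

/-! ### Orthogonal invariance implies the three discrete and infinitesimal relations. -/

section

variable {d : ℕ} {ι : Type} [Fintype ι] [DecidableEq ι]

/-- The tensor `r` is fixed by `O ⊗ ⋯ ⊗ O` for all orthogonal `O`. -/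
def TensorInv (r : (ι → Fin d) → ℂ) : Prop :=
  ∀ (O : OGroup d) (f : ι → Fin d),
    ∑ f', (∏ m, (((O : Matrix (Fin d) (Fin d) ℝ) (f m) (f' m) : ℝ) : ℂ)) * r f' = r f

theorem mem_OGroup_iff {O : Matrix (Fin d) (Fin d) ℝ} : O ∈ OGroup d ↔ O * Oᵀ = 1 := by
  rw [Matrix.mem_unitaryGroup_iff, Matrix.star_eq_conjTranspose, Matrix.conjTranspose_eq_transpose_of_trivial]

omit [DecidableEq ι] in
theorem prod_ite_eq_ite_fun {R : Type*} [CommSemiring R] (f h : ι → Fin d) :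
    ∏ m, (if f m = h m then (1 : R) else 0) = if f = h then 1 else 0 := by
  by_cases hf : f = h
  · simp [hf]
  · rw [if_neg hf]
    obtain ⟨m, hm⟩ := Function.ne_iff.mp hf
    exact Finset.prod_eq_zero (Finset.mem_univ m) (if_neg hm)

/-- The matrix of the permutation `σ`. -/
def permOrth (σ : Equiv.Perm (Fin d)) : OGroup d :=
  ⟨Matrix.of fun i j => if j = σ i then 1 else 0, by
    rw [mem_OGroup_iff]
    ext i j
    simp [Matrix.mul_apply, Matrix.one_apply, eq_comm]⟩

/-- The diagonal matrix that changes the sign of the basis vector `c`. -/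
def signOrth (c : Fin d) : OGroup d :=
  ⟨Matrix.diagonal fun i => if i = c then -1 else 1, by
    rw [mem_OGroup_iff, Matrix.diagonal_transpose, Matrix.diagonal_mul_diagonal,
      ← Matrix.diagonal_one]
    congr 1
    funext i
    split_ifs <;> norm_num⟩

/-- The generator of rotations in the plane of the basis vectors `a` and `b`. -/
def planeGen (a b : Fin d) : Matrix (Fin d) (Fin d) ℝ :=
  Matrix.single a b 1 - Matrix.single b a 1

/-- The projection to the plane of the basis vectors `a` and `b`. -/
def planeProj (a b : Fin d) : Matrix (Fin d) (Fin d) ℝ :=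
  Matrix.single a a 1 + Matrix.single b b 1

/-- The rotation by the angle `θ` in the plane of the basis vectors `a` and `b`. -/
noncomputable def rotationOrth (a b : Fin d) (hab : a ≠ b) (θ : ℝ) : OGroup d :=
  ⟨1 + (Real.cos θ - 1) • planeProj a b + Real.sin θ • planeGen a b, by
    rw [mem_OGroup_iff]
    have hA : (planeGen a b)ᵀ = -planeGen a b := by
      simp [planeGen]
    have hP : (planeProj a b)ᵀ = planeProj a b := by simp [planeProj]
    have hAA : planeGen a b * planeGen a b = -planeProj a b := by
      simp [planeGen, planeProj, Matrix.sub_mul, Matrix.mul_sub, hab, hab.symm]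
      abel
    have hPP : planeProj a b * planeProj a b = planeProj a b := by
      simp [planeProj, Matrix.add_mul, Matrix.mul_add, hab, hab.symm]
    have hAP : planeGen a b * planeProj a b = planeGen a b := by
      simp [planeGen, planeProj, Matrix.sub_mul, Matrix.mul_add, hab, hab.symm]
      abel
    have hPA : planeProj a b * planeGen a b = planeGen a b := by
      simp [planeGen, planeProj, Matrix.add_mul, Matrix.mul_sub, hab, hab.symm]
    simp only [Matrix.transpose_add, Matrix.transpose_smul, Matrix.transpose_one, hA, hP,
      Matrix.add_mul, Matrix.mul_add, Matrix.smul_mul, Matrix.mul_smul, Matrix.mul_neg, hAA, hPP,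
      hAP, hPA, Matrix.one_mul, Matrix.mul_one, smul_neg]
    have := Real.sin_sq_add_cos_sq θ
    have h2 : (Real.sin θ ^ 2) • planeProj a b = (1 - Real.cos θ ^ 2) • planeProj a b := by
      rw [← this]
      congr 1
      ring
    linear_combination (norm := module) h2⟩

theorem hasDerivAt_rotationOrth (a b : Fin d) (hab : a ≠ b) (i j : Fin d) :
    HasDerivAt (fun θ => (((rotationOrth a b hab θ : Matrix (Fin d) (Fin d) ℝ) i j : ℝ) : ℂ))
      ((planeGen a b i j : ℝ) : ℂ) 0 := by
  refine HasDerivAt.ofReal_comp ?_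
  have h1 := (((Real.hasDerivAt_cos 0).sub_const 1).mul_const (planeProj a b i j)).const_add
    ((1 : Matrix (Fin d) (Fin d) ℝ) i j)
  have h2 := h1.add ((Real.hasDerivAt_sin 0).mul_const (planeGen a b i j))
  simpa [rotationOrth, Pi.add_def] using h2

theorem rotationOrth_zero (a b : Fin d) (hab : a ≠ b) (i j : Fin d) :
    (rotationOrth a b hab 0 : Matrix (Fin d) (Fin d) ℝ) i j = if j = i then 1 else 0 := by
  simp [rotationOrth, Matrix.one_apply, eq_comm]

theorem planeGen_apply (a b i j : Fin d) : planeGen a b i j =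
    (if i = a then if j = b then 1 else 0 else 0) -
      (if i = b then if j = a then 1 else 0 else 0) := by
  simp only [planeGen, Matrix.sub_apply, Matrix.single_apply, ite_and, eq_comm]

theorem prod_erase_mul_ite (f f' : ι → Fin d) (m : ι) (x : Fin d) :
    (∏ k ∈ Finset.univ.erase m, (if f' k = f k then (1 : ℂ) else 0)) *
      (if f' m = x then 1 else 0) = if f' = Function.update f m x then 1 else 0 := by
  rw [← prod_ite_eq_ite_fun, ← Finset.prod_erase_mul _ _ (Finset.mem_univ m),
    Function.update_self]
  congr 1
  refine Finset.prod_congr rfl fun k hk => ?_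
  rw [Function.update_of_ne (Finset.ne_of_mem_erase hk)]

/-- The relations come from permutation matrices, from the reflection of one basis vector, and from
differentiating at angle zero the invariance under plane rotations. -/
theorem TensorInv.isInv {r : (ι → Fin d) → ℂ} (h : TensorInv r) : IsInv r where
  perm σ f := by
    rw [← h (permOrth σ) f]
    have h1 : ∀ f', (∏ m, (((permOrth σ : Matrix (Fin d) (Fin d) ℝ) (f m) (f' m) : ℝ) : ℂ)) =
        if f' = σ ∘ f then 1 else 0 := by
      intro f'
      rw [← prod_ite_eq_ite_fun]
      simp [permOrth, apply_ite]
    simp [h1]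
  sign c f hf := by
    have h0 := h (signOrth c) f
    have h1 : ∀ f', (∏ m, (((signOrth c : Matrix (Fin d) (Fin d) ℝ) (f m) (f' m) : ℝ) : ℂ)) =
        if f' = f then -1 else 0 := by
      intro f'
      have h2 : ∀ m, (((signOrth c : Matrix (Fin d) (Fin d) ℝ) (f m) (f' m) : ℝ) : ℂ) =
          (if f' m = f m then 1 else 0) * (if f m = c then -1 else 1) := by
        intro m
        simp only [signOrth, Matrix.diagonal_apply]
        by_cases h3 : f m = f' m
        · rw [if_pos h3, if_pos h3.symm]
          split_ifs <;> simp
        · simp [h3, Ne.symm h3]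
      rw [Finset.prod_congr rfl fun m _ => h2 m, Finset.prod_mul_distrib, prod_ite_eq_ite_fun,
        Finset.prod_ite, Finset.prod_const, Finset.prod_const_one, hf.neg_one_pow]
      split_ifs <;> simp
    simp only [h1, ite_mul, zero_mul, Finset.sum_ite_eq', Finset.mem_univ, if_true] at h0
    linear_combination -(1 / 2 : ℂ) * h0
  lie a b hab f := by
    have h1 : HasDerivAt (fun θ : ℝ => ∑ f', (∏ m, (((rotationOrth a b hab θ :
        Matrix (Fin d) (Fin d) ℝ) (f m) (f' m) : ℝ) : ℂ)) * r f')
        (∑ f', (∑ m, (∏ k ∈ Finset.univ.erase m, (((rotationOrth a b hab 0 :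
          Matrix (Fin d) (Fin d) ℝ) (f k) (f' k) : ℝ) : ℂ)) •
          ((planeGen a b (f m) (f' m) : ℝ) : ℂ)) * r f') 0 :=
      HasDerivAt.fun_sum fun f' _ => (HasDerivAt.fun_finsetProd fun m _ =>
        hasDerivAt_rotationOrth a b hab _ _).mul_const _
    have h2 : (fun θ : ℝ => ∑ f', (∏ m, (((rotationOrth a b hab θ :
        Matrix (Fin d) (Fin d) ℝ) (f m) (f' m) : ℝ) : ℂ)) * r f') = fun _ => r f :=
      funext fun θ => h _ f
    rw [h2] at h1
    have h3 := h1.unique (hasDerivAt_const _ _)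
    refine Eq.trans ?_ h3
    simp only [Finset.sum_mul]
    rw [Finset.sum_comm]
    refine Finset.sum_congr rfl fun m _ => ?_
    have h4 : ∀ f' : ι → Fin d, (∏ k ∈ Finset.univ.erase m, (((rotationOrth a b hab 0 :
          Matrix (Fin d) (Fin d) ℝ) (f k) (f' k) : ℝ) : ℂ)) •
          ((planeGen a b (f m) (f' m) : ℝ) : ℂ) =
        (if f m = a then (if f' = Function.update f m b then 1 else 0) else 0) -
        (if f m = b then (if f' = Function.update f m a then 1 else 0) else 0) := by
      intro f'
      rw [← prod_erase_mul_ite, ← prod_erase_mul_ite, planeGen_apply]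
      simp only [rotationOrth_zero, smul_eq_mul]
      split_ifs <;> simp [apply_ite]
    simp only [h4, sub_mul, Finset.sum_sub_distrib]
    congr 1 <;> split_ifs <;> simp

end

/-! ### Conjugation on tensor powers, leg by leg. -/

section

variable {d t : ℕ}

section tensorConj

theorem tensorPower_mul (A B : Matrix (Fin d) (Fin d) ℂ) :
    tensorPower t (A * B) = tensorPower t A * tensorPower t B := by
  ext i j
  simp only [tensorPower, Matrix.mul_apply, Finset.prod_univ_sum, Fintype.piFinset_univ,
    Finset.prod_mul_distrib]

theorem tensorPower_one : tensorPower t (1 : Matrix (Fin d) (Fin d) ℂ) = 1 := by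
  ext i j
  simp only [tensorPower, Matrix.one_apply]
  exact prod_ite_eq_ite_fun i j

theorem tensorConj_mul (A B : Matrix (Fin d) (Fin d) ℂ)
    (M : Matrix (Fin t → Fin d) (Fin t → Fin d) ℂ) :
    tensorConj t (A * B) M = tensorConj t A (tensorConj t B M) := by
  simp only [tensorConj, tensorPower_mul, Matrix.conjTranspose_mul, Matrix.mul_assoc]

theorem tensorConj_one (M : Matrix (Fin t → Fin d) (Fin t → Fin d) ℂ) :
    tensorConj t 1 M = M := by
  simp [tensorConj, tensorPower_one]

theorem tensorConj_add (A : Matrix (Fin d) (Fin d) ℂ)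
    (M N : Matrix (Fin t → Fin d) (Fin t → Fin d) ℂ) :
    tensorConj t A (M + N) = tensorConj t A M + tensorConj t A N := by
  simp only [tensorConj, Matrix.mul_add, Matrix.add_mul]

theorem tensorConj_smul (A : Matrix (Fin d) (Fin d) ℂ) (c : ℂ)
    (M : Matrix (Fin t → Fin d) (Fin t → Fin d) ℂ) :
    tensorConj t A (c • M) = c • tensorConj t A M := by
  simp only [tensorConj, Matrix.mul_smul, Matrix.smul_mul]

/-- `tensorConj t A` as a linear map. -/
noncomputable def tensorConjLin (t : ℕ) (A : Matrix (Fin d) (Fin d) ℂ) :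
    Matrix (Fin t → Fin d) (Fin t → Fin d) ℂ →ₗ[ℂ] Matrix (Fin t → Fin d) (Fin t → Fin d) ℂ where
  toFun := tensorConj t A
  map_add' := tensorConj_add A
  map_smul' := tensorConj_smul A

theorem tensorConj_sum {κ : Type*} (s : Finset κ) (A : Matrix (Fin d) (Fin d) ℂ)
    (M : κ → Matrix (Fin t → Fin d) (Fin t → Fin d) ℂ) :
    tensorConj t A (∑ x ∈ s, M x) = ∑ x ∈ s, tensorConj t A (M x) :=
  map_sum (tensorConjLin t A) M s

/-- A matrix on the tensor power as a tensor with `2 t` legs. -/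
def flatten (X : Matrix (Fin t → Fin d) (Fin t → Fin d) ℂ) (h : Fin t ⊕ Fin t → Fin d) : ℂ :=
  X (h ∘ Sum.inl) (h ∘ Sum.inr)

theorem flatten_elim (X : Matrix (Fin t → Fin d) (Fin t → Fin d) ℂ) (i j : Fin t → Fin d) :
    flatten X (Sum.elim i j) = X i j := rfl

theorem eq_zero_of_flatten {X : Matrix (Fin t → Fin d) (Fin t → Fin d) ℂ} (h : flatten X = 0) :
    X = 0 := by
  ext i j
  exact congrFun h (Sum.elim i j)

/-- The matrix by which `tensorConj t A` acts on the leg `m`. -/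
def legMatrix (A : Matrix (Fin d) (Fin d) ℂ) : Fin t ⊕ Fin t → Matrix (Fin d) (Fin d) ℂ :=
  Sum.elim (fun _ => A) (fun _ => A.map (starRingEnd ℂ))

theorem sum_labels {M : Type*} [AddCommMonoid M] (F : (Fin t ⊕ Fin t → Fin d) → M) :
    ∑ f, F f = ∑ k, ∑ l, F (Sum.elim k l) := by
  rw [← Equiv.sum_comp (Equiv.sumArrowEquivProdArrow _ _ _).symm, Fintype.sum_prod_type]
  rfl

theorem flatten_tensorConj (A : Matrix (Fin d) (Fin d) ℂ)
    (X : Matrix (Fin t → Fin d) (Fin t → Fin d) ℂ) (h : Fin t ⊕ Fin t → Fin d) :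
    flatten (tensorConj t A X) h = ∑ f, (∏ m, legMatrix A m (h m) (f m)) * flatten X f := by
  rw [sum_labels, Finset.sum_comm]
  simp only [flatten, tensorConj, Matrix.mul_apply, Finset.sum_mul, tensorPower,
    Matrix.conjTranspose_apply, Fintype.prod_sum_type, legMatrix, Sum.elim_inl, Sum.elim_inr,
    Matrix.map_apply, Sum.elim_comp_inl, Sum.elim_comp_inr, Function.comp_apply, star_prod]
  refine Finset.sum_congr rfl fun l _ => Finset.sum_congr rfl fun k _ => ?_
  simp only [starRingEnd_apply]
  ring

theorem legMatrix_complexify (O : OGroup d) (m : Fin t ⊕ Fin t) (x y : Fin d) :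
    legMatrix (complexify d O : Matrix (Fin d) (Fin d) ℂ) m x y =
      (((O : Matrix (Fin d) (Fin d) ℝ) x y : ℝ) : ℂ) := by
  rcases m with m | m
  · rfl
  · exact Complex.conj_ofReal _

theorem isInv_flatten {X : Matrix (Fin t → Fin d) (Fin t → Fin d) ℂ}
    (hX : ∀ O : OGroup d, tensorConj t (complexify d O : Matrix (Fin d) (Fin d) ℂ) X = X) :
    IsInv (flatten X) := by
  refine TensorInv.isInv fun O f => ?_
  have h := flatten_tensorConj (complexify d O : Matrix (Fin d) (Fin d) ℂ) X f
  rw [hX] at h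
  simpa only [legMatrix_complexify] using h.symm

end tensorConj

/-! ### Brauer diagrams and their invariance. -/

section brauer

/-- The Brauer diagram of the pairing `u`, as a matrix. -/
def brauer (u : Fin t ⊕ Fin t → Fin t) : Matrix (Fin t → Fin d) (Fin t → Fin d) ℂ :=
  ∑ g : Fin t → Fin d, Matrix.single (g ∘ u ∘ Sum.inl) (g ∘ u ∘ Sum.inr) 1

theorem comp_eq_iff_of_sum {h f : Fin t ⊕ Fin t → Fin d} :
    h = f ↔ h ∘ Sum.inl = f ∘ Sum.inl ∧ h ∘ Sum.inr = f ∘ Sum.inr :=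
  ⟨fun e => by simp [e], fun e => by
    rw [← Sum.elim_comp_inl_inr h, e.1, e.2, Sum.elim_comp_inl_inr]⟩

theorem flatten_brauer (u : Fin t ⊕ Fin t → Fin t) (h : Fin t ⊕ Fin t → Fin d) :
    flatten (brauer u) h = ∑ g : Fin t → Fin d, if h = g ∘ u then 1 else 0 := by
  simp only [flatten, brauer, Matrix.sum_apply, Matrix.single_apply]
  refine Finset.sum_congr rfl fun g _ => if_congr ?_ rfl rfl
  rw [comp_eq_iff_of_sum, eq_comm, @eq_comm _ (g ∘ u ∘ Sum.inr)]
  rfl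

theorem sum_prod_comp {ι : Type} [Fintype ι] {n : ℕ} (u : ι → Fin n) (A : ι → Fin d → ℂ) :
    ∑ g : Fin n → Fin d, ∏ m, A m (g (u m)) =
      ∏ p, ∑ x, ∏ m ∈ Finset.univ.filter (fun m => u m = p), A m x := by
  rw [Finset.prod_univ_sum, Fintype.piFinset_univ]
  refine Finset.sum_congr rfl fun g _ => ?_
  rw [← Finset.prod_fiberwise Finset.univ u]
  refine Finset.prod_congr rfl fun p _ => Finset.prod_congr rfl fun m hm => ?_
  rw [(Finset.mem_filter.mp hm).2]

/-- The contribution of the pair `p` of `u` to the entry `h` of `A^{⊗ t} (brauer u) (A^{⊗ t})†`. -/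
def pairFactor (u : Fin t ⊕ Fin t → Fin t) (A : Matrix (Fin d) (Fin d) ℂ)
    (h : Fin t ⊕ Fin t → Fin d) (p : Fin t) : ℂ :=
  ∑ x, ∏ m ∈ Finset.univ.filter (fun m => u m = p), legMatrix A m (h m) x

theorem flatten_tensorConj_brauer (u : Fin t ⊕ Fin t → Fin t) (A : Matrix (Fin d) (Fin d) ℂ)
    (h : Fin t ⊕ Fin t → Fin d) :
    flatten (tensorConj t A (brauer u)) h = ∏ p, pairFactor u A h p := by
  simp only [pairFactor]
  rw [← sum_prod_comp u fun m => legMatrix A m (h m), flatten_tensorConj]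
  simp only [flatten_brauer, Finset.mul_sum, mul_ite, mul_one, mul_zero]
  rw [Finset.sum_comm]
  simp

theorem pairFactor_of_pair {u : Fin t ⊕ Fin t → Fin t} {p : Fin t} {m₁ m₂ : Fin t ⊕ Fin t}
    (hne : m₁ ≠ m₂) (hp : Finset.univ.filter (fun m => u m = p) = {m₁, m₂})
    (A : Matrix (Fin d) (Fin d) ℂ) (h : Fin t ⊕ Fin t → Fin d) :
    pairFactor u A h p = ∑ x, legMatrix A m₁ (h m₁) x * legMatrix A m₂ (h m₂) x := by
  simp only [pairFactor, hp, Finset.prod_pair hne]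

theorem sum_mul_conj_unitary (U : UGroup d) (x y : Fin d) :
    ∑ z, (U : Matrix (Fin d) (Fin d) ℂ) x z * starRingEnd ℂ ((U : Matrix (Fin d) (Fin d) ℂ) y z) =
      if x = y then 1 else 0 := by
  have h := congrFun (congrFun (Matrix.mem_unitaryGroup_iff.mp U.2) x) y
  rw [Matrix.one_apply] at h
  rw [← h, Matrix.mul_apply]
  rfl

/-- One leg carries `U` and the other its conjugate, so the factor is an entry of `U U† = 1`. -/
theorem pairFactor_cross {u : Fin t ⊕ Fin t → Fin t} {p a b : Fin t}
    (hp : Finset.univ.filter (fun m => u m = p) = {Sum.inl a, Sum.inr b})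
    (U : UGroup d) (h : Fin t ⊕ Fin t → Fin d) :
    pairFactor u (U : Matrix (Fin d) (Fin d) ℂ) h p =
      if h (Sum.inl a) = h (Sum.inr b) then 1 else 0 := by
  rw [pairFactor_of_pair (by simp) hp, ← sum_mul_conj_unitary U]
  rfl

/-- A real matrix acts alike on row and column legs, so `O Oᵀ = 1` removes it from every pair, not
only from row-column pairs. -/
theorem pairFactor_complexify {u : Fin t ⊕ Fin t → Fin t} {p : Fin t} {m₁ m₂ : Fin t ⊕ Fin t}
    (hne : m₁ ≠ m₂) (hp : Finset.univ.filter (fun m => u m = p) = {m₁, m₂})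
    (O : OGroup d) (h : Fin t ⊕ Fin t → Fin d) :
    pairFactor u (complexify d O : Matrix (Fin d) (Fin d) ℂ) h p =
      if h m₁ = h m₂ then 1 else 0 := by
  rw [pairFactor_of_pair hne hp, ← sum_mul_conj_unitary (complexify d O)]
  refine Finset.sum_congr rfl fun x _ => ?_
  rw [legMatrix_complexify, legMatrix_complexify]
  exact congrArg _ (Complex.conj_ofReal _).symm

theorem tensorConj_complexify_brauer {u : Fin t ⊕ Fin t → Fin t} (hu : IsPairing u)
    (O : OGroup d) :
    tensorConj t (complexify d O : Matrix (Fin d) (Fin d) ℂ) (brauer u) = brauer u := by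
  -- No pair factor depends on `O`, so `O` may be replaced by the identity.
  have key : ∀ O : OGroup d, flatten (tensorConj t (complexify d O : Matrix (Fin d) (Fin d) ℂ)
      (brauer u)) = flatten (tensorConj t (complexify d 1 : Matrix (Fin d) (Fin d) ℂ)
      (brauer u)) := by
    intro O
    funext h
    rw [flatten_tensorConj_brauer, flatten_tensorConj_brauer]
    refine Finset.prod_congr rfl fun p _ => ?_
    obtain ⟨m₁, m₂, hne, hp⟩ := Finset.card_eq_two.mp (hu p)
    rw [pairFactor_complexify hne hp, pairFactor_complexify hne hp]
  rw [map_one, Submonoid.coe_one, tensorConj_one] at key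
  ext i j
  exact congrFun (key O) (Sum.elim i j)

/-- Every pair of `u` joins a row index to a column index. -/
def IsCross (u : Fin t ⊕ Fin t → Fin t) : Prop :=
  ∀ p, ∃ a b, Finset.univ.filter (fun m => u m = p) = {Sum.inl a, Sum.inr b}

theorem tensorConj_brauer_of_isCross {u : Fin t ⊕ Fin t → Fin t} (hu : IsCross u) (U : UGroup d) :
    tensorConj t (U : Matrix (Fin d) (Fin d) ℂ) (brauer u) = brauer u := by
  have key : ∀ U : UGroup d, flatten (tensorConj t (U : Matrix (Fin d) (Fin d) ℂ)
      (brauer u)) = flatten (tensorConj t ((1 : UGroup d) : Matrix (Fin d) (Fin d) ℂ)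
      (brauer u)) := by
    intro U
    funext h
    rw [flatten_tensorConj_brauer, flatten_tensorConj_brauer]
    refine Finset.prod_congr rfl fun p _ => ?_
    obtain ⟨a, b, hp⟩ := hu p
    rw [pairFactor_cross hp, pairFactor_cross hp]
  rw [Submonoid.coe_one, tensorConj_one] at key
  ext i j
  exact congrFun (key U) (Sum.elim i j)

theorem IsCross.isPairing {u : Fin t ⊕ Fin t → Fin t} (hu : IsCross u) : IsPairing u := by
  intro p
  obtain ⟨a, b, hp⟩ := hu p
  rw [hp, Finset.card_pair (by simp)]

/-- The complete contraction of `M` along a pairing is invariant under orthogonal conjugation. -/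
theorem sum_flatten_tensorConj_comp {u : Fin t ⊕ Fin t → Fin t} (hu : IsPairing u) (O : OGroup d)
    (M : Matrix (Fin t → Fin d) (Fin t → Fin d) ℂ) :
    ∑ g : Fin t → Fin d, flatten (tensorConj t (complexify d O : Matrix (Fin d) (Fin d) ℂ) M)
      (g ∘ u) = ∑ g : Fin t → Fin d, flatten M (g ∘ u) := by
  simp only [flatten_tensorConj, legMatrix_complexify]
  rw [Finset.sum_comm]
  simp only [← Finset.sum_mul, Function.comp_apply]
  -- The matrix entries of `O` are moved onto the diagram, where they act as `O⁻¹ = Oᵀ`, which fixes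
  -- it.
  have h1 : ∀ f : Fin t ⊕ Fin t → Fin d, ∑ g : Fin t → Fin d,
      ∏ m, (((O : Matrix (Fin d) (Fin d) ℝ) (g (u m)) (f m) : ℝ) : ℂ) =
      flatten (brauer u) f := by
    intro f
    rw [← tensorConj_complexify_brauer hu O⁻¹, flatten_tensorConj_brauer,
      sum_prod_comp u fun m x => (((O : Matrix (Fin d) (Fin d) ℝ) x (f m) : ℝ) : ℂ)]
    refine Finset.prod_congr rfl fun p _ => Finset.sum_congr rfl fun x _ =>
      Finset.prod_congr rfl fun m _ => ?_
    rw [legMatrix_complexify]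
    rfl
  simp only [h1, flatten_brauer, Finset.sum_mul, ite_mul, one_mul, zero_mul]
  rw [Finset.sum_comm]
  simp

end brauer

end

/-! ### Haar measure, twirls, and the duality with Brauer diagrams. -/

section

variable {d t : ℕ}

section haar

variable (𝕜 : Type*) [RCLike 𝕜]

instance isHaarMeasure_haarProb : (haarProb d 𝕜).IsHaarMeasure := by
  unfold haarProb
  infer_instance

instance isProbabilityMeasure_haarProb : IsProbabilityMeasure (haarProb d 𝕜) :=
  ⟨by simpa [haarProb] using Measure.haarMeasure_self (K₀ := (⊤ :
    TopologicalSpace.PositiveCompacts (Matrix.unitaryGroup (Fin d) 𝕜)))⟩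

/-- Compact groups are unimodular: a right translate of the measure is a left-invariant measure of
the same mass, hence a multiple of it with factor one. -/
instance isMulRightInvariant_haarProb : (haarProb d 𝕜).IsMulRightInvariant where
  map_mul_right_eq_self g := by
    have hc := Measure.isMulInvariant_eq_smul_of_compactSpace
      (Measure.map (· * g) (haarProb d 𝕜)) (haarProb d 𝕜)
    have h1 : Measure.map (· * g) (haarProb d 𝕜) Set.univ = 1 := by
      rw [Measure.map_apply (measurable_mul_const g) MeasurableSet.univ, Set.preimage_univ,
        measure_univ]
    have h2 := congrArg (fun μ => μ Set.univ) hc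
    simp only [h1, Measure.smul_apply, measure_univ] at h2
    rw [hc]
    have h3 : Measure.haarScalarFactor (Measure.map (· * g) (haarProb d 𝕜)) (haarProb d 𝕜) = 1 := by
      have : ((Measure.haarScalarFactor (Measure.map (· * g) (haarProb d 𝕜)) (haarProb d 𝕜) :
        NNReal) : ENNReal) = 1 := by
        rw [h2, ENNReal.smul_def, smul_eq_mul, mul_one]
      exact_mod_cast this
    rw [h3, one_smul]

end haar

theorem continuous_tensorConj_apply (M : Matrix (Fin t → Fin d) (Fin t → Fin d) ℂ)
    (i j : Fin t → Fin d) :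
    Continuous fun A : Matrix (Fin d) (Fin d) ℂ => tensorConj t A M i j := by
  have h : Continuous fun A : Matrix (Fin d) (Fin d) ℂ => tensorPower t A :=
    continuous_matrix fun i j => continuous_finsetProd _ fun k _ =>
      continuous_id.matrix_elem (i k) (j k)
  exact ((h.matrix_mul continuous_const).matrix_mul h.matrix_conjTranspose).matrix_elem i j

theorem integrable_unitary (M : Matrix (Fin t → Fin d) (Fin t → Fin d) ℂ) (i j : Fin t → Fin d) :
    Integrable (fun U : UGroup d => tensorConj t (U : Matrix (Fin d) (Fin d) ℂ) M i j)
      (haarProb d ℂ) :=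
  ((continuous_tensorConj_apply M i j).comp
    continuous_subtype_val).integrable_of_hasCompactSupport (HasCompactSupport.of_compactSpace _)

theorem continuous_complexify : Continuous fun O : OGroup d =>
    (complexify d O : Matrix (Fin d) (Fin d) ℂ) :=
  (continuous_subtype_val (p := fun A => A ∈ OGroup d)).matrix_map Complex.continuous_ofReal

theorem integrable_orthogonal (M : Matrix (Fin t → Fin d) (Fin t → Fin d) ℂ)
    (i j : Fin t → Fin d) :
    Integrable (fun O : OGroup d =>
      tensorConj t (complexify d O : Matrix (Fin d) (Fin d) ℂ) M i j) (haarProb d ℝ) :=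
  ((continuous_tensorConj_apply M i j).comp
    continuous_complexify).integrable_of_hasCompactSupport (HasCompactSupport.of_compactSpace _)

theorem unitaryTwirl_add (M N : Matrix (Fin t → Fin d) (Fin t → Fin d) ℂ) :
    unitaryTwirl t (M + N) = unitaryTwirl t M + unitaryTwirl t N := by
  ext i j
  simp only [unitaryTwirl, tensorConj_add, Matrix.add_apply]
  exact integral_add (integrable_unitary M i j) (integrable_unitary N i j)

theorem unitaryTwirl_smul (c : ℂ) (M : Matrix (Fin t → Fin d) (Fin t → Fin d) ℂ) :
    unitaryTwirl t (c • M) = c • unitaryTwirl t M := by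
  ext i j
  simp only [unitaryTwirl, tensorConj_smul, Matrix.smul_apply]
  exact integral_smul c _

/-- The unitary twirl as a linear map. -/
noncomputable def unitaryTwirlLin (t d : ℕ) :
    Matrix (Fin t → Fin d) (Fin t → Fin d) ℂ →ₗ[ℂ] Matrix (Fin t → Fin d) (Fin t → Fin d) ℂ where
  toFun := unitaryTwirl t
  map_add' := unitaryTwirl_add
  map_smul' := unitaryTwirl_smul

theorem unitaryTwirl_tensorConj (U : UGroup d) (M : Matrix (Fin t → Fin d) (Fin t → Fin d) ℂ) :
    unitaryTwirl t (tensorConj t (U : Matrix (Fin d) (Fin d) ℂ) M) = unitaryTwirl t M := by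
  ext i j
  simp only [unitaryTwirl, ← tensorConj_mul, ← Submonoid.coe_mul]
  exact integral_mul_right_eq_self
    (fun V : UGroup d => tensorConj t (V : Matrix (Fin d) (Fin d) ℂ) M i j) U

theorem unitaryTwirl_eq_self {M : Matrix (Fin t → Fin d) (Fin t → Fin d) ℂ}
    (h : ∀ U : UGroup d, tensorConj t (U : Matrix (Fin d) (Fin d) ℂ) M = M) :
    unitaryTwirl t M = M := by
  ext i j
  simp [unitaryTwirl, h]

theorem orthogonalTwirl_tensorConj (O : OGroup d)
    (M : Matrix (Fin t → Fin d) (Fin t → Fin d) ℂ) :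
    orthogonalTwirl t (tensorConj t (complexify d O : Matrix (Fin d) (Fin d) ℂ) M) =
      orthogonalTwirl t M := by
  ext i j
  simp only [orthogonalTwirl, ← tensorConj_mul, ← Submonoid.coe_mul, ← map_mul]
  exact integral_mul_right_eq_self
    (fun V : OGroup d => tensorConj t (complexify d V : Matrix (Fin d) (Fin d) ℂ) M i j) O

theorem orthogonalTwirl_eq_self {M : Matrix (Fin t → Fin d) (Fin t → Fin d) ℂ}
    (h : ∀ O : OGroup d, tensorConj t (complexify d O : Matrix (Fin d) (Fin d) ℂ) M = M) :
    orthogonalTwirl t M = M := by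
  ext i j
  simp [orthogonalTwirl, h]

/-- Conjugation commutes with the integral that defines the orthogonal twirl. -/
theorem tensorConj_orthogonalTwirl_apply (A : Matrix (Fin d) (Fin d) ℂ)
    (M : Matrix (Fin t → Fin d) (Fin t → Fin d) ℂ) (i j : Fin t → Fin d) :
    tensorConj t A (orthogonalTwirl t M) i j =
      ∫ O : OGroup d, tensorConj t A
        (tensorConj t (complexify d O : Matrix (Fin d) (Fin d) ℂ) M) i j ∂(haarProb d ℝ) := by
  have h1 : ∀ X : Matrix (Fin t → Fin d) (Fin t → Fin d) ℂ, tensorConj t A X i j =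
      ∑ f, (∏ m, legMatrix A m ((Sum.elim i j : Fin t ⊕ Fin t → Fin d) m) (f m)) * flatten X f :=
    fun X => flatten_tensorConj A X (Sum.elim i j)
  simp only [h1]
  refine Eq.trans ?_ (integral_finsetSum _ fun f _ =>
    (integrable_orthogonal M (f ∘ Sum.inl) (f ∘ Sum.inr)).const_mul _).symm
  refine Finset.sum_congr rfl fun f _ => ?_
  exact (integral_const_mul _ _).symm

theorem tensorConj_orthogonalTwirl (O : OGroup d)
    (M : Matrix (Fin t → Fin d) (Fin t → Fin d) ℂ) :
    tensorConj t (complexify d O : Matrix (Fin d) (Fin d) ℂ) (orthogonalTwirl t M) =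
      orthogonalTwirl t M := by
  ext i j
  rw [tensorConj_orthogonalTwirl_apply]
  simp only [← tensorConj_mul, ← Submonoid.coe_mul, ← map_mul]
  exact integral_mul_left_eq_self
    (fun V : OGroup d => tensorConj t (complexify d V : Matrix (Fin d) (Fin d) ℂ) M i j) O

theorem sum_flatten_orthogonalTwirl_comp {u : Fin t ⊕ Fin t → Fin t} (hu : IsPairing u)
    (M : Matrix (Fin t → Fin d) (Fin t → Fin d) ℂ) :
    ∑ g : Fin t → Fin d, flatten (orthogonalTwirl t M) (g ∘ u) =
      ∑ g : Fin t → Fin d, flatten M (g ∘ u) := by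
  have h : ∑ g : Fin t → Fin d, flatten (orthogonalTwirl t M) (g ∘ u) =
      ∫ O : OGroup d, ∑ g : Fin t → Fin d,
        flatten (tensorConj t (complexify d O : Matrix (Fin d) (Fin d) ℂ) M) (g ∘ u)
        ∂(haarProb d ℝ) :=
    (integral_finsetSum _ fun g _ => integrable_orthogonal M _ _).symm
  rw [h]
  simp [sum_flatten_tensorConj_comp hu]

/-- A linear map that is invariant under orthogonal conjugation of its argument and annihilates
all Brauer diagrams is zero. -/
theorem eq_zero_of_brauer (ht : t ≤ 3)
    (Φ : Matrix (Fin t → Fin d) (Fin t → Fin d) ℂ →ₗ[ℂ] ℂ)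
    (hinv : ∀ (O : OGroup d) M,
      Φ (tensorConj t (complexify d O : Matrix (Fin d) (Fin d) ℂ) M) = Φ M)
    (hΦ : ∀ u : Fin t ⊕ Fin t → Fin t, IsPairing u → Φ (brauer u) = 0) : Φ = 0 := by
  have hexp : ∀ M, Φ M = ∑ f, flatten M f *
      Φ (Matrix.single (f ∘ Sum.inl) (f ∘ Sum.inr) 1) := by
    intro M
    conv_lhs => rw [Matrix.matrix_eq_sum_single M]
    rw [sum_labels, map_sum]
    refine Finset.sum_congr rfl fun k _ => ?_
    rw [map_sum]
    refine Finset.sum_congr rfl fun l _ => ?_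
    rw [Sum.elim_comp_inl, Sum.elim_comp_inr, flatten_elim, ← smul_eq_mul, ← map_smul,
      Matrix.smul_single, smul_eq_mul, mul_one]
  -- The coefficients of `Φ` on matrix units form a tensor. Invariance of `Φ` makes it orthogonally
  -- invariant, and its contraction along `u` is `Φ (brauer u)`.
  have hρ : (fun f : Fin t ⊕ Fin t → Fin d =>
      Φ (Matrix.single (f ∘ Sum.inl) (f ∘ Sum.inr) 1)) = 0 := by
    refine IsInv.eq_zero_of_pairings ht (by simp [two_mul]) (TensorInv.isInv fun O f => ?_)
      fun u hu => ?_
    · rw [← hinv O⁻¹ (Matrix.single (f ∘ Sum.inl) (f ∘ Sum.inr) 1), hexp]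
      refine Finset.sum_congr rfl fun f' _ => ?_
      rw [flatten_tensorConj, Finset.sum_eq_single f]
      · simp only [flatten, Matrix.single_apply_same, mul_one, legMatrix_complexify]
        rfl
      · intro f'' _ hne
        rw [flatten, Matrix.single_apply, if_neg, mul_zero]
        rintro ⟨h1, h2⟩
        exact hne (comp_eq_iff_of_sum.mpr ⟨h1.symm, h2.symm⟩)
      · simp
    · rw [← hΦ u hu, brauer, map_sum]
      rfl
  ext M
  rw [hexp]
  simp [fun f => congrFun hρ f]

end

/-! ### Classification of pairings for `t ≤ 3`. -/

section

variable {d t : ℕ}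

section pairings

theorem fiber_eq_disjSum (u : Fin t ⊕ Fin t → Fin t) (p : Fin t) :
    Finset.univ.filter (fun m => u m = p) =
      (Finset.univ.filter fun a => u (Sum.inl a) = p).disjSum
        (Finset.univ.filter fun b => u (Sum.inr b) = p) := by
  ext m
  rcases m with m | m <;> simp

/-- Here `n p` counts the row indices in the pair `p`. Their mean is one, so twos and zeros are
equally many; two of each would need `t ≥ 4`. -/
theorem counts_eq_one_or (ht : t ≤ 3) (n : Fin t → Fin 3) (h : ∑ p, (n p : ℕ) = t) :
    (∀ p, n p = 1) ∨ ∃ p p', p ≠ p' ∧ n p = 2 ∧ n p' = 0 ∧ ∀ q, q ≠ p → q ≠ p' → n q = 1 := by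
  revert n
  interval_cases t <;> decide

/-- The pairs `p` and `p'` of `u` join two row indices `a`, `b` and two column indices `c`, `e`,
respectively, and all other pairs join a row index to a column index. -/
structure IsCup (u : Fin t ⊕ Fin t → Fin t) (p p' a b c e : Fin t) : Prop where
  ne : p ≠ p'
  ne_row : a ≠ b
  ne_col : c ≠ e
  row : Finset.univ.filter (fun m => u m = p) = {Sum.inl a, Sum.inl b}
  col : Finset.univ.filter (fun m => u m = p') = {Sum.inr c, Sum.inr e}
  cross : ∀ q, q ≠ p → q ≠ p' →
    ∃ x y, Finset.univ.filter (fun m => u m = q) = {Sum.inl x, Sum.inr y}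

theorem isCross_or_isCup (ht : t ≤ 3) {u : Fin t ⊕ Fin t → Fin t} (hu : IsPairing u) :
    IsCross u ∨ ∃ p p' a b c e, IsCup u p p' a b c e := by
  have hsum : ∀ p, (Finset.univ.filter fun a => u (Sum.inl a) = p).card +
      (Finset.univ.filter fun b => u (Sum.inr b) = p).card = 2 := by
    intro p
    rw [← Finset.card_disjSum, ← fiber_eq_disjSum, hu p]
  have hcross : ∀ p, (Finset.univ.filter fun a => u (Sum.inl a) = p).card = 1 →
      ∃ x y, Finset.univ.filter (fun m => u m = p) = {Sum.inl x, Sum.inr y} := by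
    intro p hp
    obtain ⟨x, hx⟩ := Finset.card_eq_one.mp hp
    obtain ⟨y, hy⟩ := Finset.card_eq_one.mp (by have := hsum p; omega :
      (Finset.univ.filter fun b => u (Sum.inr b) = p).card = 1)
    refine ⟨x, y, ?_⟩
    rw [fiber_eq_disjSum, hx, hy]
    ext m
    rcases m with m | m <;> simp
  have htot : ∑ p, (Finset.univ.filter fun a => u (Sum.inl a) = p).card = t := by
    have := Finset.card_eq_sum_card_fiberwise (f := fun a => u (Sum.inl a))
      (s := Finset.univ) (t := Finset.univ) (fun _ _ => Finset.mem_univ _)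
    simpa using this.symm
  rcases counts_eq_one_or ht (fun p => ⟨(Finset.univ.filter fun a => u (Sum.inl a) = p).card, by
    have := hsum p; omega⟩) htot with h | ⟨p, p', hne, hp, hp', h⟩
  · exact Or.inl fun p => hcross p (by simpa using congrArg Fin.val (h p))
  · right
    have hp2 : (Finset.univ.filter fun a => u (Sum.inl a) = p).card = 2 := by
      simpa using congrArg Fin.val hp
    have hp0 : (Finset.univ.filter fun a => u (Sum.inl a) = p').card = 0 := by
      simpa using congrArg Fin.val hp'
    obtain ⟨a, b, hab, hrow⟩ := Finset.card_eq_two.mp hp2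
    obtain ⟨c, e, hce, hcol⟩ := Finset.card_eq_two.mp (by have := hsum p'; omega :
      (Finset.univ.filter fun b => u (Sum.inr b) = p').card = 2)
    have hrow0 : (Finset.univ.filter fun b => u (Sum.inr b) = p) = ∅ :=
      Finset.card_eq_zero.mp (by have := hsum p; omega)
    refine ⟨p, p', a, b, c, e, hne, hab, hce, ?_, ?_, fun q h1 h2 =>
      hcross q (by simpa using congrArg Fin.val (h q h1 h2))⟩
    · rw [fiber_eq_disjSum, hrow, hrow0]
      ext m
      rcases m with m | m <;> simp
    · rw [fiber_eq_disjSum, hcol, Finset.card_eq_zero.mp hp0]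
      ext m
      rcases m with m | m <;> simp

theorem IsCup.symm_col {u : Fin t ⊕ Fin t → Fin t} {p p' a b c e : Fin t}
    (h : IsCup u p p' a b c e) : IsCup u p p' a b e c :=
  { h with
    ne_col := h.ne_col.symm
    col := by rw [h.col, Finset.pair_comm] }

theorem filter_comp_swap (u : Fin t ⊕ Fin t → Fin t) (x y : Fin t ⊕ Fin t) (q : Fin t) :
    Finset.univ.filter (fun m => (u ∘ Equiv.swap x y) m = q) =
      (Finset.univ.filter fun m => u m = q).image (Equiv.swap x y) := by
  ext m
  simp only [Finset.mem_filter, Finset.mem_univ, true_and, Finset.mem_image, Function.comp_apply]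
  exact ⟨fun h => ⟨_, h, Equiv.swap_apply_self x y m⟩, by rintro ⟨m, h, rfl⟩; simpa using h⟩

/-- The pairing obtained from a cup by reconnecting row indices to column indices. -/
def uncup (u : Fin t ⊕ Fin t → Fin t) (b c : Fin t) : Fin t ⊕ Fin t → Fin t :=
  u ∘ Equiv.swap (Sum.inl b) (Sum.inr c)

section uncup

variable {u : Fin t ⊕ Fin t → Fin t} {p p' a b c e : Fin t} (h : IsCup u p p' a b c e)
include h

theorem IsCup.uncup_fst : Finset.univ.filter (fun m => uncup u b c m = p) =
    {Sum.inl a, Sum.inr c} := by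
  rw [uncup, filter_comp_swap, h.row, Finset.image_insert, Finset.image_singleton,
    Equiv.swap_apply_left, Equiv.swap_apply_of_ne_of_ne (by simpa using h.ne_row) (by simp)]

theorem IsCup.uncup_snd : Finset.univ.filter (fun m => uncup u b c m = p') =
    {Sum.inl b, Sum.inr e} := by
  rw [uncup, filter_comp_swap, h.col, Finset.image_insert, Finset.image_singleton,
    Equiv.swap_apply_right, Equiv.swap_apply_of_ne_of_ne (by simp) (by simpa using h.ne_col.symm)]

theorem IsCup.uncup_other {q : Fin t} (h1 : q ≠ p) (h2 : q ≠ p') :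
    Finset.univ.filter (fun m => uncup u b c m = q) = Finset.univ.filter (fun m => u m = q) := by
  have hb : u (Sum.inl b) = p := by
    have := Finset.ext_iff.mp h.row (Sum.inl b)
    simpa using this
  have hc : u (Sum.inr c) = p' := by
    have := Finset.ext_iff.mp h.col (Sum.inr c)
    simpa using this
  ext m
  simp only [Finset.mem_filter, Finset.mem_univ, true_and]
  change u (Equiv.swap (Sum.inl b) (Sum.inr c) m) = q ↔ _
  by_cases hmb : m = Sum.inl b
  · subst hmb
    rw [Equiv.swap_apply_left, hb, hc]
    exact iff_of_false h2.symm h1.symm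
  by_cases hmc : m = Sum.inr c
  · subst hmc
    rw [Equiv.swap_apply_right, hb, hc]
    exact iff_of_false h1.symm h2.symm
  rw [Equiv.swap_apply_of_ne_of_ne hmb hmc]

theorem IsCup.isCross_uncup : IsCross (uncup u b c) := by
  intro q
  by_cases h1 : q = p
  · exact ⟨a, c, h1 ▸ h.uncup_fst⟩
  by_cases h2 : q = p'
  · exact ⟨b, e, h2 ▸ h.uncup_snd⟩
  rw [h.uncup_other h1 h2]
  exact h.cross q h1 h2

end uncup

theorem flatten_brauer_eq_prod (u : Fin t ⊕ Fin t → Fin t) (h : Fin t ⊕ Fin t → Fin d) :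
    flatten (brauer u) h =
      ∏ p, pairFactor u ((1 : UGroup d) : Matrix (Fin d) (Fin d) ℂ) h p := by
  rw [← flatten_tensorConj_brauer, Submonoid.coe_one, tensorConj_one]

theorem prod_eq_mul_mul_prod_erase {p p' : Fin t} (hne : p ≠ p') (F : Fin t → ℂ) :
    ∏ q, F q = F p * F p' * ∏ q ∈ (Finset.univ.erase p).erase p', F q := by
  rw [← Finset.mul_prod_erase _ _ (Finset.mem_univ p), mul_assoc,
    Finset.mul_prod_erase _ _ (Finset.mem_erase.mpr ⟨hne.symm, Finset.mem_univ p'⟩)]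

variable {u : Fin t ⊕ Fin t → Fin t} {p p' a b c e : Fin t}

/-- The part of the diagram of a cup that belongs to the pairs other than `p` and `p'`. -/
noncomputable def restFactor (u : Fin t ⊕ Fin t → Fin t) (p p' : Fin t)
    (h : Fin t ⊕ Fin t → Fin d) : ℂ :=
  ∏ q ∈ (Finset.univ.erase p).erase p', pairFactor u ((1 : UGroup d) : Matrix (Fin d) (Fin d) ℂ) h q

theorem IsCup.flatten_brauer_uncup (hu : IsCup u p p' a b c e) (h : Fin t ⊕ Fin t → Fin d) :
    flatten (brauer (uncup u b c)) h =
      (if h (Sum.inl a) = h (Sum.inr c) then 1 else 0) *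
        (if h (Sum.inl b) = h (Sum.inr e) then 1 else 0) * restFactor u p p' h := by
  rw [flatten_brauer_eq_prod, prod_eq_mul_mul_prod_erase hu.ne, pairFactor_cross hu.uncup_fst,
    pairFactor_cross hu.uncup_snd, restFactor]
  congr 1
  refine Finset.prod_congr rfl fun q hq => ?_
  have h1 := Finset.mem_erase.mp hq
  rw [pairFactor, pairFactor, hu.uncup_other (Finset.ne_of_mem_erase h1.2) h1.1]

/-- The row-row pair multiplies `U` by its transpose, the column-column pair does so with
conjugates, and unitarity removes `U` from the remaining pairs. -/
theorem IsCup.flatten_tensorConj (hu : IsCup u p p' a b c e) (U : UGroup d)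
    (h : Fin t ⊕ Fin t → Fin d) :
    flatten (tensorConj t (U : Matrix (Fin d) (Fin d) ℂ) (brauer u)) h =
      ((U : Matrix (Fin d) (Fin d) ℂ) * (U : Matrix (Fin d) (Fin d) ℂ)ᵀ)
          (h (Sum.inl a)) (h (Sum.inl b)) *
        starRingEnd ℂ (((U : Matrix (Fin d) (Fin d) ℂ) * (U : Matrix (Fin d) (Fin d) ℂ)ᵀ)
          (h (Sum.inr c)) (h (Sum.inr e))) * restFactor u p p' h := by
  rw [flatten_tensorConj_brauer, prod_eq_mul_mul_prod_erase hu.ne,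
    pairFactor_of_pair (by simpa using hu.ne_row) hu.row,
    pairFactor_of_pair (by simpa using hu.ne_col) hu.col, restFactor, Matrix.mul_apply,
    Matrix.mul_apply, map_sum]
  congr 1
  · congr 1
    refine Finset.sum_congr rfl fun x _ => ?_
    rw [map_mul]
    rfl
  · refine Finset.prod_congr rfl fun q hq => ?_
    have h1 := Finset.mem_erase.mp hq
    obtain ⟨x, y, hxy⟩ := hu.cross q (Finset.ne_of_mem_erase h1.2) h1.1
    rw [pairFactor_cross hxy, pairFactor_cross hxy]

end pairings

end

/-! ### The second-order moment that determines `α`. -/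

section

variable {d t : ℕ}

section moment

theorem omegaPow_add (x y : ℝ) : omegaPow d (x + y) = omegaPow d x * omegaPow d y := by
  rw [omegaPow, omegaPow, omegaPow, ← Complex.exp_add]
  push_cast
  ring_nf

theorem omegaPow_mul_conj (x : ℝ) : omegaPow d x * starRingEnd ℂ (omegaPow d x) = 1 := by
  rw [omegaPow, ← Complex.exp_conj, ← Complex.exp_add]
  simp [neg_div, Complex.conj_ofNat]

theorem W_inv_apply (α : ℝ) (i j : Fin d) : ((W d α)⁻¹ : UGroup d) i j =
    if i = j then starRingEnd ℂ (omegaPow d ((j : ℕ) * α)) else 0 := by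
  change star (Matrix.diagonal fun j : Fin d => omegaPow d ((j : ℕ) * α)) i j = _
  rw [Matrix.star_eq_conjTranspose, Matrix.diagonal_conjTranspose, Matrix.diagonal_apply]
  split_ifs with h
  · subst h; rfl
  · rfl

/-- The pairing of two row indices and of two column indices. -/
def cupPairing : Fin 2 ⊕ Fin 2 → Fin 2 := Sum.elim (fun _ => 0) (fun _ => 1)

theorem isCup_cupPairing : IsCup cupPairing 0 1 0 1 0 1 :=
  ⟨by decide, by decide, by decide, by decide, by decide, by decide⟩

theorem restFactor_two (u : Fin 2 ⊕ Fin 2 → Fin 2) (h : Fin 2 ⊕ Fin 2 → Fin d) :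
    restFactor u 0 1 h = 1 := by
  rw [restFactor, show ((Finset.univ : Finset (Fin 2)).erase 0).erase 1 = ∅ by decide,
    Finset.prod_empty]

theorem W_inv_mul_transpose (α : ℝ) (i j : Fin d) :
    ((((W d α)⁻¹ : UGroup d) : Matrix (Fin d) (Fin d) ℂ) *
      (((W d α)⁻¹ : UGroup d) : Matrix (Fin d) (Fin d) ℂ)ᵀ) i j =
    if i = j then starRingEnd ℂ (omegaPow d (2 * α * (i : ℕ))) else 0 := by
  rw [Matrix.mul_apply]
  simp only [Matrix.transpose_apply, W_inv_apply, ite_mul, zero_mul, Finset.sum_ite_eq,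
    Finset.mem_univ, if_true, mul_ite, mul_zero]
  split_ifs with h
  swap
  · rfl
  subst h
  rw [← map_mul, ← omegaPow_add]
  ring_nf

theorem sum_two_labels (F : (Fin 2 → Fin d) → ℂ) : ∑ g, F g = ∑ x, ∑ y, F ![x, y] := by
  rw [← Equiv.sum_comp (finTwoArrowEquiv (Fin d)).symm, Fintype.sum_prod_type]
  rfl

/-- The `W`-conjugated cup diagram and the symmetric projection (suitably normalized) have the same
complete contractions. -/
theorem sum_flatten_cup_comp {α : ℝ} (hα : q d α = 2 * d / (d + 1))
    {u : Fin 2 ⊕ Fin 2 → Fin 2} (hu : IsPairing u) :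
    ∑ g : Fin 2 → Fin d, flatten (tensorConj 2 (((W d α)⁻¹ : UGroup d) : Matrix (Fin d) (Fin d) ℂ)
        (brauer cupPairing)) (g ∘ u) =
      1 / (d + 1) * ∑ g : Fin 2 → Fin d, (flatten (brauer (uncup cupPairing 1 0)) (g ∘ u) +
        flatten (brauer (uncup cupPairing 1 1)) (g ∘ u)) := by
  have hd : (d + 1 : ℂ) ≠ 0 := by exact_mod_cast Nat.succ_ne_zero d
  simp only [isCup_cupPairing.flatten_tensorConj, isCup_cupPairing.flatten_brauer_uncup,
    isCup_cupPairing.symm_col.flatten_brauer_uncup, restFactor_two, W_inv_mul_transpose, mul_one,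
    sum_two_labels]
  set v : Fin d → ℂ := fun x => omegaPow d (2 * α * (x : ℕ)) with hv
  have hvv : ∀ x, starRingEnd ℂ (v x) * v x = 1 := fun x => by
    rw [mul_comm]; exact omegaPow_mul_conj _
  -- Contracting with the cup itself gives `q d α` on the left and `2 d / (d + 1)` on the right;
  -- only this pairing constrains `α`. The two row-column pairings give `d` on both sides.
  have hq : ∑ x, ∑ y, starRingEnd ℂ (v x) * v y = 2 * d / (d + 1) := by
    rw [← Finset.sum_mul_sum, ← map_sum, mul_comm, Complex.mul_conj, Complex.normSq_eq_norm_sq]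
    have := congrArg (fun x : ℝ => (x : ℂ)) hα
    simpa [q] using this
  have hq' : ∑ x, ∑ y, starRingEnd ℂ (v y) * v x = 2 * d / (d + 1) := by
    rw [Finset.sum_comm, hq]
  have hv' : ∀ x : Fin d, omegaPow d (2 * α * (x : ℕ)) = v x := fun _ => rfl
  simp only [hv', Function.comp_apply]
  have h0 := hu 0
  rw [Finset.card_filter, Fintype.sum_sum_type, Fin.sum_univ_two, Fin.sum_univ_two] at h0
  obtain ⟨p₁, h₁⟩ : ∃ p, u (Sum.inl 0) = p := ⟨_, rfl⟩
  obtain ⟨p₂, h₂⟩ : ∃ p, u (Sum.inl 1) = p := ⟨_, rfl⟩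
  obtain ⟨p₃, h₃⟩ : ∃ p, u (Sum.inr 0) = p := ⟨_, rfl⟩
  obtain ⟨p₄, h₄⟩ : ∃ p, u (Sum.inr 1) = p := ⟨_, rfl⟩
  simp only [h₁, h₂, h₃, h₄] at h0 ⊢
  clear h₁ h₂ h₃ h₄ hu
  -- Of the sixteen maps `u`, the condition that the value `0` is taken twice leaves six: three
  -- pairings, each with two numberings of its pairs.
  fin_cases p₁ <;> fin_cases p₂ <;> fin_cases p₃ <;> fin_cases p₄ <;> (try (simp at h0; done)) <;>
    simp [ hvv, hq, hq', Finset.sum_add_distrib] <;>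
    field_simp <;> ring

/-- Both sides are orthogonally invariant with four legs, so equality of complete contractions is
enough. -/
theorem orthogonalTwirl_cup_two {α : ℝ} (hα : q d α = 2 * d / (d + 1)) :
    orthogonalTwirl 2 (tensorConj 2 (((W d α)⁻¹ : UGroup d) : Matrix (Fin d) (Fin d) ℂ)
      (brauer cupPairing)) = (1 / (d + 1) : ℂ) •
        (brauer (uncup cupPairing 1 0) + brauer (uncup cupPairing 1 1)) := by
  have h1 := isCup_cupPairing.isCross_uncup
  have h2 := isCup_cupPairing.symm_col.isCross_uncup
  rw [← sub_eq_zero]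
  refine eq_zero_of_flatten (IsInv.eq_zero_of_pairings (n := 2) (by norm_num) (by simp)
    (isInv_flatten fun O => ?_) fun u hu => ?_)
  · rw [sub_eq_add_neg, ← neg_smul, tensorConj_add, tensorConj_smul, tensorConj_add,
      tensorConj_orthogonalTwirl, tensorConj_brauer_of_isCross h1, tensorConj_brauer_of_isCross h2]
  · have h3 : ∀ X Y Z : Matrix (Fin 2 → Fin d) (Fin 2 → Fin d) ℂ, ∀ c : ℂ, ∀ h,
        flatten (X - c • (Y + Z)) h = flatten X h - c * (flatten Y h + flatten Z h) :=
      fun X Y Z c h => rfl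
    simp only [h3]
    rw [Finset.sum_sub_distrib, sum_flatten_orthogonalTwirl_comp hu, sum_flatten_cup_comp hα hu,
      Finset.mul_sum, sub_self]

theorem tensorConj_W_orthogonalTwirl_apply (α : ℝ)
    (M : Matrix (Fin t → Fin d) (Fin t → Fin d) ℂ) (h : Fin t ⊕ Fin t → Fin d) :
    flatten (tensorConj t (W d α : Matrix (Fin d) (Fin d) ℂ) (orthogonalTwirl t
      (tensorConj t (((W d α)⁻¹ : UGroup d) : Matrix (Fin d) (Fin d) ℂ) M))) h =
    ∫ O : OGroup d, flatten (tensorConj t ((W d α * complexify d O * (W d α)⁻¹ : UGroup d) :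
      Matrix (Fin d) (Fin d) ℂ) M) h ∂(haarProb d ℝ) := by
  rw [flatten, tensorConj_orthogonalTwirl_apply]
  simp only [Submonoid.coe_mul, tensorConj_mul]
  rfl

/-- The fourth moments of `U Uᵀ` for `U = W O W†` with a random orthogonal `O`. -/
theorem integral_mul_transpose {α : ℝ} (hα : q d α = 2 * d / (d + 1)) (a b c e : Fin d) :
    ∫ O : OGroup d,
      (((W d α * complexify d O * (W d α)⁻¹ : UGroup d) : Matrix (Fin d) (Fin d) ℂ) *
        ((W d α * complexify d O * (W d α)⁻¹ : UGroup d) : Matrix (Fin d) (Fin d) ℂ)ᵀ) a b *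
      starRingEnd ℂ
        ((((W d α * complexify d O * (W d α)⁻¹ : UGroup d) : Matrix (Fin d) (Fin d) ℂ) *
        ((W d α * complexify d O * (W d α)⁻¹ : UGroup d) : Matrix (Fin d) (Fin d) ℂ)ᵀ) c e)
      ∂(haarProb d ℝ) =
    1 / (d + 1) * ((if a = c then 1 else 0) * (if b = e then 1 else 0) +
      (if a = e then 1 else 0) * (if b = c then 1 else 0)) := by
  have h := tensorConj_W_orthogonalTwirl_apply α (brauer cupPairing) (Sum.elim ![a, b] ![c, e])
  simp only [isCup_cupPairing.flatten_tensorConj, restFactor_two, mul_one] at h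
  rw [orthogonalTwirl_cup_two hα, tensorConj_smul, tensorConj_add,
    tensorConj_brauer_of_isCross isCup_cupPairing.isCross_uncup,
    tensorConj_brauer_of_isCross isCup_cupPairing.symm_col.isCross_uncup] at h
  refine h.symm.trans ?_
  change (1 / (d + 1) : ℂ) * (flatten (brauer (uncup cupPairing 1 0)) _ +
    flatten (brauer (uncup cupPairing 1 1)) _) = _
  rw [isCup_cupPairing.flatten_brauer_uncup, isCup_cupPairing.symm_col.flatten_brauer_uncup,
    restFactor_two, mul_one, mul_one]
  rfl

theorem tensorConj_W_orthogonalTwirl_cup {α : ℝ} (hα : q d α = 2 * d / (d + 1))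
    {u : Fin t ⊕ Fin t → Fin t} {p p' a b c e : Fin t} (hu : IsCup u p p' a b c e) :
    tensorConj t (W d α : Matrix (Fin d) (Fin d) ℂ) (orthogonalTwirl t
      (tensorConj t (((W d α)⁻¹ : UGroup d) : Matrix (Fin d) (Fin d) ℂ) (brauer u))) =
    (1 / (d + 1) : ℂ) • (brauer (uncup u b c) + brauer (uncup u b e)) := by
  ext i j
  have h := tensorConj_W_orthogonalTwirl_apply α (brauer u) (Sum.elim i j)
  simp only [hu.flatten_tensorConj] at h
  rw [integral_mul_const, integral_mul_transpose hα] at h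
  refine h.trans ?_
  change _ = (1 / (d + 1) : ℂ) * (flatten (brauer (uncup u b c)) (Sum.elim i j) +
    flatten (brauer (uncup u b e)) (Sum.elim i j))
  rw [hu.flatten_brauer_uncup, hu.symm_col.flatten_brauer_uncup]
  ring

/-- Averaging a Brauer diagram over the conjugated orthogonal group gives a matrix that commutes
with the action of the whole unitary group. -/
theorem tensorConj_W_orthogonalTwirl_brauer (ht : t ≤ 3) {α : ℝ}
    (hα : q d α = 2 * d / (d + 1)) {u : Fin t ⊕ Fin t → Fin t} (hu : IsPairing u) (U : UGroup d) :
    tensorConj t (U : Matrix (Fin d) (Fin d) ℂ)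
      (tensorConj t (W d α : Matrix (Fin d) (Fin d) ℂ) (orthogonalTwirl t
        (tensorConj t (((W d α)⁻¹ : UGroup d) : Matrix (Fin d) (Fin d) ℂ) (brauer u)))) =
    tensorConj t (W d α : Matrix (Fin d) (Fin d) ℂ) (orthogonalTwirl t
      (tensorConj t (((W d α)⁻¹ : UGroup d) : Matrix (Fin d) (Fin d) ℂ) (brauer u))) := by
  rcases isCross_or_isCup ht hu with h | ⟨p, p', a, b, c, e, h⟩
  · rw [tensorConj_brauer_of_isCross h, orthogonalTwirl_eq_self fun O =>
      tensorConj_brauer_of_isCross h _, tensorConj_brauer_of_isCross h,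
      tensorConj_brauer_of_isCross h]
  · rw [tensorConj_W_orthogonalTwirl_cup hα h, tensorConj_smul, tensorConj_add,
      tensorConj_brauer_of_isCross h.isCross_uncup,
      tensorConj_brauer_of_isCross h.symm_col.isCross_uncup]

end moment

end

/-! ### From moments to designs. -/

section

variable {d t : ℕ}

section designs

theorem isCross_id : IsCross (Sum.elim id id : Fin t ⊕ Fin t → Fin t) := by
  intro p
  refine ⟨p, p, ?_⟩
  ext m
  rcases m with m | m <;> simp

/-- Test the design equation on the identity diagram, which every conjugation fixes. A nonzero entry
to compare exists because `d ≥ 1`. -/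
theorem IsOrthogonalDesign.sum_weight (hd : 1 ≤ d) {V : Finset (OGroup d)} {w : OGroup d → ℝ}
    (h : IsOrthogonalDesign t V w) : ∑ O ∈ V, w O = 1 := by
  have h1 := h.sum_eq (brauer (Sum.elim id id))
  simp only [tensorConj_complexify_brauer isCross_id.isPairing,
    orthogonalTwirl_eq_self fun O => tensorConj_complexify_brauer isCross_id.isPairing O] at h1
  rw [← Finset.sum_smul] at h1
  have h2 : flatten (brauer (Sum.elim id id : Fin t ⊕ Fin t → Fin t))
      (fun _ => (⟨0, hd⟩ : Fin d)) = 1 := by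
    rw [flatten_brauer_eq_prod]
    refine Finset.prod_eq_one fun p _ => ?_
    obtain ⟨a, b, hp⟩ := isCross_id p
    rw [pairFactor_cross hp, if_pos rfl]
  have h3 := congrArg (fun X => flatten X fun _ => (⟨0, hd⟩ : Fin d)) h1
  have h4 : (∑ O ∈ V, (w O : ℂ)) * flatten (brauer (Sum.elim id id : Fin t ⊕ Fin t → Fin t))
      (fun _ => (⟨0, hd⟩ : Fin d)) = flatten (brauer (Sum.elim id id : Fin t ⊕ Fin t → Fin t))
      (fun _ => (⟨0, hd⟩ : Fin d)) := h3
  rw [h2, mul_one] at h4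
  exact_mod_cast h4

/-- The average of the conjugations by `w`-random elements of `V`, as a linear map. -/
noncomputable def averageLin (t : ℕ) (V : Finset (OGroup d)) (w : OGroup d → ℝ)
    (π : OGroup d → UGroup d) :
    Matrix (Fin t → Fin d) (Fin t → Fin d) ℂ →ₗ[ℂ] Matrix (Fin t → Fin d) (Fin t → Fin d) ℂ :=
  ∑ O ∈ V, (w O : ℂ) • tensorConjLin t (π O : Matrix (Fin d) (Fin d) ℂ)

theorem averageLin_apply (V : Finset (OGroup d)) (w : OGroup d → ℝ) (π : OGroup d → UGroup d)
    (M : Matrix (Fin t → Fin d) (Fin t → Fin d) ℂ) : averageLin t V w π M =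
      ∑ O ∈ V, (w O : ℂ) • tensorConj t (π O : Matrix (Fin d) (Fin d) ℂ) M := by
  simp only [averageLin, LinearMap.sum_apply, LinearMap.smul_apply]
  rfl

theorem unitaryTwirl_averageLin {V : Finset (OGroup d)} {w : OGroup d → ℝ}
    (hw : ∑ O ∈ V, w O = 1) (π : OGroup d → UGroup d)
    (M : Matrix (Fin t → Fin d) (Fin t → Fin d) ℂ) :
    unitaryTwirl t (averageLin t V w π M) = unitaryTwirl t M := by
  change unitaryTwirlLin t d _ = _
  rw [averageLin_apply, map_sum]
  simp only [map_smul]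
  change ∑ O ∈ V, (w O : ℂ) • unitaryTwirl t _ = _
  simp only [unitaryTwirl_tensorConj]
  rw [← Finset.sum_smul]
  have : ∑ O ∈ V, (w O : ℂ) = 1 := by exact_mod_cast hw
  rw [this, one_smul]

theorem averageLin_conj (V : Finset (OGroup d)) (w : OGroup d → ℝ) (U : UGroup d)
    (M : Matrix (Fin t → Fin d) (Fin t → Fin d) ℂ) :
    averageLin t V w (fun A => U * complexify d A * U⁻¹) M =
      tensorConj t (U : Matrix (Fin d) (Fin d) ℂ) (averageLin t V w (complexify d)
        (tensorConj t ((U⁻¹ : UGroup d) : Matrix (Fin d) (Fin d) ℂ) M)) := by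
  rw [averageLin_apply, averageLin_apply, tensorConj_sum]
  simp only [tensorConj_smul, ← tensorConj_mul, Submonoid.coe_mul, Matrix.mul_assoc]

theorem averageLin_comp_eq_unitaryTwirl (hd : 1 ≤ d) (ht : t ≤ 3) {α : ℝ}
    (hα : q d α = 2 * d / (d + 1)) {V : Finset (OGroup d)} {w : OGroup d → ℝ}
    (h : IsOrthogonalDesign t V w) (M : Matrix (Fin t → Fin d) (Fin t → Fin d) ℂ) :
    averageLin t V w (fun A => W d α * complexify d A * (W d α)⁻¹)
      (averageLin t V w (complexify d) M) = unitaryTwirl t M := by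
  have hS : ∀ M, averageLin t V w (complexify d) M = orthogonalTwirl t M := fun M => by
    rw [averageLin_apply, h.sum_eq]
  set S' := averageLin t V w (fun A => W d α * complexify d A * (W d α)⁻¹) with hS'
  have hfix : ∀ u : Fin t ⊕ Fin t → Fin t, IsPairing u →
      S' (brauer u) = unitaryTwirl t (brauer u) := by
    intro u hu
    -- Averaging over unitaries with total weight one does not change the unitary twirl, and a
    -- unitarily invariant matrix is its own twirl; so it is enough that `S' (brauer u)` is
    -- unitarily invariant.
    rw [← unitaryTwirl_averageLin (h.sum_weight hd)
      (fun A => W d α * complexify d A * (W d α)⁻¹) (brauer u), ← hS']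
    refine (unitaryTwirl_eq_self fun U => ?_).symm
    rw [hS', averageLin_conj, hS]
    exact tensorConj_W_orthogonalTwirl_brauer ht hα hu U
  ext i j
  -- Apply the duality to each matrix entry of the difference of the two maps; on a diagram the
  -- inner average acts as the identity.
  have h0 := eq_zero_of_brauer ht (Matrix.entryLinearMap ℂ ℂ i j ∘ₗ
    (S' ∘ₗ averageLin t V w (complexify d) - unitaryTwirlLin t d)) (fun O M => by
      simp only [LinearMap.comp_apply, LinearMap.sub_apply, hS, orthogonalTwirl_tensorConj]
      congr 2
      exact unitaryTwirl_tensorConj _ _) (fun u hu => by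
      simp only [LinearMap.comp_apply, LinearMap.sub_apply, hS]
      rw [orthogonalTwirl_eq_self fun O => tensorConj_complexify_brauer hu O, hfix u hu]
      change _ - (unitaryTwirl t (brauer u)) i j = 0
      exact sub_self _)
  have h1 := congrArg (fun Φ => Φ M) h0
  exact sub_eq_zero.mp h1

theorem mem_productSet {A B : Finset (UGroup d)} {X : UGroup d} :
    X ∈ productSet ![A, B] ↔ ∃ a ∈ A, ∃ b ∈ B, a * b = X := by
  simp only [productSet, Finset.mem_image, Fintype.mem_piFinset, Fin.forall_fin_two]
  constructor
  · rintro ⟨h, ⟨h0, h1⟩, rfl⟩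
    exact ⟨h 0, h0, h 1, h1, by simp⟩
  · rintro ⟨a, ha, b, hb, rfl⟩
    exact ⟨![a, b], ⟨ha, hb⟩, by simp⟩

theorem mul_mem_productSet (U : UGroup d) {V : Finset (OGroup d)} {A B : OGroup d}
    (hA : A ∈ V) (hB : B ∈ V) :
    U * complexify d A * U⁻¹ * complexify d B ∈ productSet ![conjSet U V, complexSet V] :=
  mem_productSet.mpr ⟨_, Finset.mem_image_of_mem _ hA, _, Finset.mem_image_of_mem _ hB, rfl⟩

theorem isUnitaryDesign_convolutionWeight (hd : 1 ≤ d) (ht : t ≤ 3) {α : ℝ}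
    (hα : q d α = 2 * d / (d + 1)) {V : Finset (OGroup d)} {w : OGroup d → ℝ}
    (h : IsOrthogonalDesign t V w) :
    IsUnitaryDesign t (productSet ![conjSet (W d α) V, complexSet V])
      (convolutionWeight (W d α) V w) where
  weight_mem X _ := by
    classical
    have hnn : ∀ p ∈ V ×ˢ V, 0 ≤ w p.1 * w p.2 := fun p hp =>
      mul_nonneg (h.weight_mem _ (Finset.mem_product.mp hp).1).1
        (h.weight_mem _ (Finset.mem_product.mp hp).2).1
    refine ⟨Finset.sum_nonneg fun p hp => hnn p (Finset.mem_filter.mp hp).1, ?_⟩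
    refine (Finset.sum_le_sum_of_subset_of_nonneg (Finset.filter_subset _ _)
      fun p hp _ => hnn p hp).trans_eq ?_
    rw [Finset.sum_product, ← Finset.sum_mul_sum, h.sum_weight hd, one_mul]
  sum_eq M := by
    classical
    rw [← averageLin_comp_eq_unitaryTwirl hd ht hα h, averageLin_apply]
    simp only [averageLin_apply, tensorConj_sum, tensorConj_smul, ← tensorConj_mul,
      ← Submonoid.coe_mul, Finset.smul_sum, smul_smul]
    -- Group the pairs in `V × V` by their product; the total weight of a group is the convolution
    -- weight.
    rw [← Finset.sum_product', ← Finset.sum_fiberwise_of_maps_to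
      (g := fun p : OGroup d × OGroup d => W d α * complexify d p.1 * (W d α)⁻¹ * complexify d p.2)
      (t := productSet ![conjSet (W d α) V, complexSet V])
      fun p hp => mul_mem_productSet _ (Finset.mem_product.mp hp).1 (Finset.mem_product.mp hp).2]
    refine Finset.sum_congr rfl fun X _ => ?_
    rw [convolutionWeight, Complex.ofReal_sum, Finset.sum_smul]
    refine Finset.sum_congr (by congr) fun p hp => ?_
    rw [(Finset.mem_filter.mp hp).2, Complex.ofReal_mul]

theorem complexify_injective : Function.Injective (complexify d) := by
  intro A B h
  ext i j
  have := congrFun (congrFun (congrArg Subtype.val h) i) j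
  exact Complex.ofReal_injective this

theorem conj_complexify_injective (U : UGroup d) :
    Function.Injective fun A : OGroup d => U * complexify d A * U⁻¹ := fun _ _ h =>
  complexify_injective (mul_left_cancel (mul_right_cancel h))

/-- Inclusion into `U(d)` and conjugation by `U` are injective, so factorizations of `X` correspond
to pairs in `V × V`, and both factors have `|V|` elements. -/
theorem productWeight_eq_convolutionWeight (U : UGroup d) (V : Finset (OGroup d)) (X : UGroup d) :
    productWeight ![conjSet U V, complexSet V] X = convolutionWeight U V (uniformWeight V) X := by
  classical
  have hcard : ((Fintype.piFinset ![conjSet U V, complexSet V]).filter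
        fun h => (List.ofFn h).prod = X).card =
      ((V ×ˢ V).filter fun p => U * complexify d p.1 * U⁻¹ * complexify d p.2 = X).card := by
    symm
    refine Finset.card_bij
      (fun p _ => ![U * complexify d p.1 * U⁻¹, complexify d p.2]) ?_ ?_ ?_
    · intro p hp
      simp only [Finset.mem_filter, Finset.mem_product] at hp
      simp only [Finset.mem_filter, Fintype.mem_piFinset, Fin.forall_fin_two]
      exact ⟨⟨Finset.mem_image_of_mem _ hp.1.1, Finset.mem_image_of_mem _ hp.1.2⟩, by
        simpa using hp.2⟩
    · intro p _ p' _ h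
      exact Prod.ext (conj_complexify_injective U (congrFun h 0))
        (complexify_injective (congrFun h 1))
    · intro h hh
      simp only [Finset.mem_filter, Fintype.mem_piFinset, Fin.forall_fin_two] at hh
      obtain ⟨A, hA, hA'⟩ := Finset.mem_image.mp hh.1.1
      obtain ⟨B, hB, hB'⟩ := Finset.mem_image.mp hh.1.2
      refine ⟨(A, B), ?_, ?_⟩
      · simp only [Finset.mem_filter, Finset.mem_product]
        refine ⟨⟨hA, hB⟩, ?_⟩
        rw [hA', hB', ← hh.2]
        simp
      · rw [hA', hB']
        funext k
        fin_cases k <;> rfl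
  have h1 : (conjSet U V).card = V.card :=
    Finset.card_image_of_injective _ (conj_complexify_injective U)
  have h2 : (complexSet V).card = V.card :=
    Finset.card_image_of_injective _ complexify_injective
  simp only [productWeight, convolutionWeight, uniformWeight, Finset.sum_const, nsmul_eq_mul,
    Fin.prod_univ_two, Matrix.cons_val_zero, Matrix.cons_val_one, h1, h2]
  rw [div_mul_div_comm, one_mul, mul_one_div]
  congr 2

theorem isUnitaryDesign_productWeight (hd : 1 ≤ d) (ht : t ≤ 3) {α : ℝ}
    (hα : q d α = 2 * d / (d + 1)) {V : Finset (OGroup d)}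
    (h : IsOrthogonalDesign t V (uniformWeight V)) :
    IsUnitaryDesign t (productSet ![conjSet (W d α) V, complexSet V])
      (productWeight ![conjSet (W d α) V, complexSet V]) := by
  rw [funext (productWeight_eq_convolutionWeight (W d α) V)]
  exact isUnitaryDesign_convolutionWeight hd ht hα h

theorem isGeneralizedGroupDesign (hd : 1 ≤ d) (ht : t ≤ 3) {α : ℝ}
    (hα : q d α = 2 * d / (d + 1)) (V : Subgroup (OGroup d))
    (hV : (V : Set (OGroup d)).Finite)
    (h : IsOrthogonalDesign t hV.toFinset (uniformWeight hV.toFinset)) :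
    IsGeneralizedGroupDesign t ![conjSubgroup (W d α) V, V.map (complexify d)] := by
  have hfin : ∀ j, ((![conjSubgroup (W d α) V, V.map (complexify d)] j : Subgroup (UGroup d)) :
      Set (UGroup d)).Finite := by
    refine Fin.forall_fin_two.mpr ⟨?_, hV.image _⟩
    exact (hV.image _).image _
  have hset : (fun j => (hfin j).toFinset) =
      ![conjSet (W d α) hV.toFinset, complexSet hV.toFinset] := by
    funext j
    revert j
    refine Fin.forall_fin_two.mpr ⟨?_, ?_⟩
    · ext X
      constructor
      · intro hX
        obtain ⟨_, ⟨A, hA, rfl⟩, rfl⟩ := (Set.Finite.mem_toFinset _).mp hX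
        exact Finset.mem_image_of_mem _ ((Set.Finite.mem_toFinset hV).mpr hA)
      · intro hX
        obtain ⟨A, hA, rfl⟩ := Finset.mem_image.mp hX
        exact (Set.Finite.mem_toFinset _).mpr
          ⟨_, ⟨A, (Set.Finite.mem_toFinset hV).mp hA, rfl⟩, rfl⟩
    · ext X
      simp [complexSet]
  refine ⟨hfin, ?_⟩
  rw [hset]
  exact isUnitaryDesign_productWeight hd ht hα h

end designs

/-! ### Existence of `α`. -/

section existence

theorem continuous_q : Continuous (q d) := by
  unfold q omegaPow
  fun_prop

theorem q_zero : q d 0 = d ^ 2 := by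
  simp [q, omegaPow]

theorem q_one (hd : 1 < d) : q d 1 = 0 := by
  have h := (Complex.isPrimitiveRoot_exp d (by omega)).geom_sum_eq_zero hd
  rw [← Fin.sum_univ_eq_sum_range] at h
  have h1 : ∀ j : Fin d, omegaPow d (2 * 1 * (j : ℕ)) =
      Complex.exp (2 * Real.pi * Complex.I / d) ^ (j : ℕ) := by
    intro j
    have hd0 : (d : ℂ) ≠ 0 := Nat.cast_ne_zero.mpr (by omega)
    rw [omegaPow, ← Complex.exp_nat_mul]
    congr 1
    push_cast
    field_simp
  rw [q, Finset.sum_congr rfl fun j _ => h1 j, h]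
  simp

/-- Intermediate value theorem: `q` is `d²` at `0`, and for `d > 1` it is `0` at `1`, where the sum
runs over all `d`-th roots of unity. For `d = 1` the value at `0` is already the target. -/
theorem exists_q_eq (hd : 1 ≤ d) : ∃ α : ℝ, q d α = 2 * d / (d + 1) := by
  have hd' : (1 : ℝ) ≤ d := by exact_mod_cast hd
  refine mem_range_of_exists_le_of_exists_ge continuous_q ?_ ⟨0, ?_⟩
  · rcases hd.eq_or_lt with rfl | hd1
    · exact ⟨0, by rw [q_zero]; norm_num⟩
    · exact ⟨1, by rw [q_one hd1]; positivity⟩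
  · rw [q_zero, div_le_iff₀ (by positivity)]
    nlinarith

end existence

end

end GroupDesign

open GroupDesign
theorem mainTheorem2 (d : ℕ) (hd : 1 ≤ d) :
    (∃ α : ℝ, q d α = 2 * d / (d + 1)) ∧
    ∀ α : ℝ, q d α = 2 * d / (d + 1) → ∀ t : ℕ, t ≤ 3 →
      (∀ (V : Subgroup (OGroup d)) (hV : (V : Set (OGroup d)).Finite),
        IsOrthogonalDesign t hV.toFinset (uniformWeight hV.toFinset) →
          IsGeneralizedGroupDesign t
            ![conjSubgroup (W d α) V, V.map (complexify d)]) ∧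
      (∀ V : Finset (OGroup d),
        IsOrthogonalDesign t V (uniformWeight V) →
          IsUnitaryDesign t (productSet ![conjSet (W d α) V, complexSet V])
            (productWeight ![conjSet (W d α) V, complexSet V])) ∧
      (∀ (V : Finset (OGroup d)) (w : OGroup d → ℝ),
        IsOrthogonalDesign t V w →
          IsUnitaryDesign t (productSet ![conjSet (W d α) V, complexSet V])
            (convolutionWeight (W d α) V w)) :=
  ⟨exists_q_eq hd, fun _ hα _ ht =>
    ⟨fun V hV h => isGeneralizedGroupDesign hd ht hα V hV h,
      fun _ h => isUnitaryDesign_productWeight hd ht hα h,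
      fun _ _ h => isUnitaryDesign_convolutionWeight hd ht hα h⟩⟩
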